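/- Conventions. All manifolds and maps are smooth, and manifolds are real and finite-dimensional. $G\rightrightarrows G_0$ is a Lie groupoid with source $s$, target $t$ and units $1_x$; the product $gh$ is defined when $t(g)=s(h)$, and then $s(gh)=s(g)$, $t(gh)=t(h)$. Its Lie algebroid is $A\to G_0$ with fibres $A_x=\ker\big(s_*:T_{1_x}G\to T_xG_0\big)$. A local bisection $\beta\in\mathscr B(G)$ is a section of $s$ over an open set $V_\beta\subset G_0$ such that $t\circ\beta$ is a diffeomorphism of $V_\beta$ onto an open subset of $G_0$; left translation is $L_\beta(g)=\beta(z)\,g$ with $t(\beta(z))=s(g)$. For $x\in V_\beta$, $\mathrm{Ad}_{\beta^{-1}}:A_x\to A_{t(\beta(x))}$ is the derivative at $1_x$ of $g\mapsto \beta(s(g))^{-1}\,g\,\beta(t(g))$. A smooth map $\gamma\in C^\infty(M,\mathscr B(G))$ is a family of local bisections $\gamma(m)$, $m\in M$, such that $\{(m,x): x\in V_{\gamma(m)}\}$ is open in $M\times G_0$ and $(m,x)\mapsto\gamma(m)(x)$ is smooth on it. For $X\in T_mM$, $\gamma_*X$ is the field $x\mapsto \frac{d}{d\tau}\big|_0\gamma(m_\tau)(x)\in\ker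 s_*\subset T_{\gamma(m)(x)}G$ along $\gamma(m)$, where $m_\tau$ is a curve in $M$ with $m_0=m$ and velocity $X$ at $\tau=0$. A principal groupoid bundle consists of a surjective submersion $\pi:P\to M$, a map $\epsilon:P\to G_0$ and a right action $(p,g)\mapsto pg$ of $G$ on $P$ along $\epsilon$ (defined when $\epsilon(p)=s(g)$) with $\pi(pg)=\pi(p)$, such that $(p,g)\mapsto(p,pg)$ is a diffeomorphism of $P\,{}_\epsilon\!\times_s G$ onto $P\times_\pi P$; its inverse is $(p,q)\mapsto(p,\delta(p,q))$, and $\delta_p=\delta(p,\cdot)$ on the fibre of $P$ through $p$. A principal connection on it is a smooth distribution $H$ with $TP=\ker\pi_*\oplus H$, $\epsilon_*H=0$ and $H_{pg}=(R_g)_*H_p$ whenever $\epsilon(p)=s(g)$. Let $\mathrm{Hor},\mathrm{Ver}$ be the projections onto $H$ and onto $\ker\pi_*$. The connection form is $\alpha(X_p)=(\delta_p)_*\mathrm{Ver}(X_p)\in A_{\epsilon(p)}$, and the curvature is $\Omega(u,v)=(\delta_p)_*\big(-\mathrm{Ver}[\mathrm{Hor}\,\tilde u,\mathrm{Hor}\,\tilde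 v]_p\big)\in A_{\epsilon(p)}$ for $u,v\in T_pP$, where $\tilde u,\tilde v$ are any vector fields near $p$ extending $u,v$. Theorem. Let $P\to M$ be a principal groupoid bundle with structure groupoid $G$ and a principal connection $H$, with connection form $\alpha$ and curvature $\Omega$. Let $U\subset M$ be open (for instance $U=M$), $\sigma:U\to P$ a section of $\pi$ over $U$, $\epsilon_\sigma=\epsilon\circ\sigma$, and $\gamma\in C^\infty(M,\mathscr B(G))$ such that $\gamma(m)$ is defined at $\epsilon_\sigma(m)$ for every $m\in U$. Put $(\sigma\cdot\gamma)(m)=\sigma(m)\cdot\gamma(m)(\epsilon_\sigma(m))$, which is again a section of $\pi$ over $U$, and $\epsilon_{\sigma,\gamma}(m)=t\big(\gamma(m)(\epsilon_\sigma(m))\big)$. For each section $\tau$ put $\theta_\tau=\tau^*\alpha$ and $\Omega_\tau=\tau^*\Omega$. Then for all $m\in U$ and $X,Y\in T_mM$ one has $\epsilon\big((\sigma\cdot\gamma)(m)\big)=\epsilon_{\sigma,\gamma}(m)$ and, in $A_{\epsilon_{\sigma,\gamma}(m)}$, $$\theta_{\sigma\cdot\gamma}(X)=\mathrm{Ad}_{\gamma(m)^{-1}}\,\theta_\sigma(X)+(\gamma^{-1}\gamma')(X),\qquad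 \Omega_{\sigma\cdot\gamma}(X,Y)=\mathrm{Ad}_{\gamma(m)^{-1}}\,\Omega_\sigma(X,Y),$$ where $(\gamma^{-1}\gamma')(X)=(L_{\gamma(m)}^{-1})_*\big((\gamma_*X)(\epsilon_\sigma(m))\big)$ is the value at $\epsilon_{\sigma,\gamma}(m)$ of the section $(L_{\gamma(m)}^{-1})_*(\gamma_*X)$ of $A$, that is, the pullback by $\gamma$ of the Maurer-Cartan form of $\mathscr B(G)$, evaluated along $\epsilon_{\sigma,\gamma}$. -/

import Mathlib

open scoped Manifold ContDiff Topology

namespace GroupoidGauge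

noncomputable section

/-- A (smooth, finite-dimensional, real) Lie groupoid with manifold of arrows `G` and manifold of
objects `G₀`. Two arrows `g`, `h` are composable when `tgt g = src h`, and then `mul g h` goes from
`src g` to `tgt h`. The multiplication is a smooth map on the fibred product
`{(g, h) | tgt g = src h}`; the values of `mul` on non-composable pairs carry no information. -/
structure LieGroupoid (EG E₀ G G₀ : Type*)
    [NormedAddCommGroup EG] [NormedSpace ℝ EG] [NormedAddCommGroup E₀] [NormedSpace ℝ E₀]
    [TopologicalSpace G] [ChartedSpace EG G] [TopologicalSpace G₀] [ChartedSpace E₀ G₀] where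
  src : G → G₀
  tgt : G → G₀
  one : G₀ → G
  mul : G → G → G
  inv : G → G
  src_one : ∀ x, src (one x) = x
  tgt_one : ∀ x, tgt (one x) = x
  src_mul : ∀ g h, tgt g = src h → src (mul g h) = src g
  tgt_mul : ∀ g h, tgt g = src h → tgt (mul g h) = tgt h
  mul_assoc : ∀ g h k, tgt g = src h → tgt h = src k → mul (mul g h) k = mul g (mul h k)
  one_mul : ∀ g, mul (one (src g)) g = g
  mul_one : ∀ g, mul g (one (tgt g)) = g
  src_inv : ∀ g, src (inv g) = tgt g
  tgt_inv : ∀ g, tgt (inv g) = src g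
  inv_mul : ∀ g, mul (inv g) g = one (tgt g)
  mul_inv : ∀ g, mul g (inv g) = one (src g)
  submersion_src : Manifold.IsSubmersion 𝓘(ℝ, EG) 𝓘(ℝ, E₀) ∞ src
  smooth_tgt : ContMDiff 𝓘(ℝ, EG) 𝓘(ℝ, E₀) ∞ tgt
  smooth_one : ContMDiff 𝓘(ℝ, E₀) 𝓘(ℝ, EG) ∞ one
  smooth_mul : ContMDiffOn (𝓘(ℝ, EG).prod 𝓘(ℝ, EG)) 𝓘(ℝ, EG) ∞
    (fun q : G × G => mul q.1 q.2) {q | tgt q.1 = src q.2}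
  smooth_inv : ContMDiff 𝓘(ℝ, EG) 𝓘(ℝ, EG) ∞ inv

section

variable {EG E₀ G G₀ : Type*}
  [NormedAddCommGroup EG] [NormedSpace ℝ EG] [NormedAddCommGroup E₀] [NormedSpace ℝ E₀]
  [TopologicalSpace G] [ChartedSpace EG G] [TopologicalSpace G₀] [ChartedSpace E₀ G₀]

/-- The fibre `A_x = ker (s_* : T_{1_x} G → T_x G₀)` of the Lie algebroid `A` of a Lie groupoid.
(In Mathlib a tangent space is the model vector space, through the preferred chart at the point;
so tangent vectors at two provably equal points are the same data.) -/
def LieGroupoid.alg (𝒢 : LieGroupoid EG E₀ G G₀) (x : G₀) :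
    Submodule ℝ (TangentSpace 𝓘(ℝ, EG) (𝒢.one x)) :=
  (mfderiv 𝓘(ℝ, EG) 𝓘(ℝ, E₀) 𝒢.src (𝒢.one x)).ker

/-- The fibre `T^s_g G = ker (s_* : T_g G → T_{s(g)} G₀)`. -/
def LieGroupoid.srcKer (𝒢 : LieGroupoid EG E₀ G G₀) (g : G) :
    Submodule ℝ (TangentSpace 𝓘(ℝ, EG) g) :=
  (mfderiv 𝓘(ℝ, EG) 𝓘(ℝ, E₀) 𝒢.src g).ker

/-- The total space of the Lie algebroid `A → G₀`. -/
abbrev LieGroupoid.Algebroid (𝒢 : LieGroupoid EG E₀ G G₀) : Type _ := Σ x : G₀, 𝒢.alg x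

theorem LieGroupoid.smooth_src (𝒢 : LieGroupoid EG E₀ G G₀) :
    ContMDiff 𝓘(ℝ, EG) 𝓘(ℝ, E₀) ∞ 𝒢.src := 𝒢.submersion_src.contMDiff

theorem LieGroupoid.mem_alg_of_eq (𝒢 : LieGroupoid EG E₀ G G₀) {g : G} {x : G₀}
    (h : g = 𝒢.one x) {v : TangentSpace 𝓘(ℝ, EG) g} (hv : v ∈ 𝒢.srcKer g) :
    (show TangentSpace 𝓘(ℝ, EG) (𝒢.one x) from v) ∈ 𝒢.alg x := by
  subst h
  exact hv

theorem LieGroupoid.mfderiv_mem_srcKer (𝒢 : LieGroupoid EG E₀ G G₀) {f : G → G} {ψ : G₀ → G₀}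
    {g : G} (hf : MDifferentiableAt 𝓘(ℝ, EG) 𝓘(ℝ, EG) f g)
    (hψ : MDifferentiableAt 𝓘(ℝ, E₀) 𝓘(ℝ, E₀) ψ (𝒢.src g))
    (h : ∀ᶠ k in 𝓝 g, 𝒢.src (f k) = ψ (𝒢.src k))
    {v : TangentSpace 𝓘(ℝ, EG) g} (hv : v ∈ 𝒢.srcKer g) :
    mfderiv 𝓘(ℝ, EG) 𝓘(ℝ, EG) f g v ∈ 𝒢.srcKer (f g) := by
  have hs : ∀ k, MDifferentiableAt 𝓘(ℝ, EG) 𝓘(ℝ, E₀) 𝒢.src k := fun k =>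
    𝒢.smooth_src.mdifferentiableAt (by simp)
  have h1 := mfderiv_comp_apply g (hs (f g)) hf v
  have h2 := mfderiv_comp_apply g hψ (hs g) v
  have h3 : mfderiv 𝓘(ℝ, EG) 𝓘(ℝ, E₀) (𝒢.src ∘ f) g = mfderiv 𝓘(ℝ, EG) 𝓘(ℝ, E₀) (ψ ∘ 𝒢.src) g :=
    Filter.EventuallyEq.mfderiv_eq h
  have hv' : mfderiv 𝓘(ℝ, EG) 𝓘(ℝ, E₀) 𝒢.src g v = 0 := hv
  change mfderiv 𝓘(ℝ, EG) 𝓘(ℝ, E₀) 𝒢.src (f g) _ = 0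
  exact h1.symm.trans ((congrArg (fun L : EG →L[ℝ] E₀ => L v) h3).trans (h2.trans
    ((congrArg (mfderiv 𝓘(ℝ, E₀) 𝓘(ℝ, E₀) ψ (𝒢.src g)) hv').trans (map_zero _))))

/-- A local bisection of a Lie groupoid: a smooth section `β` of `src` on an open subset
`base.source` of `G₀` such that `tgt ∘ β` is a diffeomorphism `base` onto an open subset
`base.target` of `G₀`. The values outside `base.source` carry no information. -/
structure LocalBisection (𝒢 : LieGroupoid EG E₀ G G₀) where
  toFun : G₀ → G
  base : OpenPartialHomeomorph G₀ G₀
  smooth_toFun : ContMDiffOn 𝓘(ℝ, E₀) 𝓘(ℝ, EG) ∞ toFun base.source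
  src_toFun : ∀ x ∈ base.source, 𝒢.src (toFun x) = x
  tgt_toFun : ∀ x ∈ base.source, 𝒢.tgt (toFun x) = base x
  smooth_base_symm : ContMDiffOn 𝓘(ℝ, E₀) 𝓘(ℝ, E₀) ∞ base.symm base.target

namespace LocalBisection

variable {𝒢 : LieGroupoid EG E₀ G G₀}

theorem smooth_base (β : LocalBisection 𝒢) :
    ContMDiffOn 𝓘(ℝ, E₀) 𝓘(ℝ, E₀) ∞ β.base β.base.source :=
  ((𝒢.smooth_tgt.comp_contMDiffOn β.smooth_toFun).congr
    fun x hx => (β.tgt_toFun x hx).symm)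

/-- The inverse local bisection `y ↦ β((t ∘ β)⁻¹ y)⁻¹`. -/
def inv (β : LocalBisection 𝒢) : LocalBisection 𝒢 where
  toFun y := 𝒢.inv (β.toFun (β.base.symm y))
  base := β.base.symm
  smooth_toFun := 𝒢.smooth_inv.comp_contMDiffOn
    (β.smooth_toFun.comp β.smooth_base_symm fun _ hy => β.base.map_target hy)
  src_toFun y hy := by
    have hy' : y ∈ β.base.target := hy
    rw [𝒢.src_inv, β.tgt_toFun _ (β.base.map_target hy'), β.base.right_inv hy']
  tgt_toFun y hy := by
    have hy' : y ∈ β.base.target := hy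
    rw [𝒢.tgt_inv, β.src_toFun _ (β.base.map_target hy')]
  smooth_base_symm := by simpa using β.smooth_base

/-- Left translation of arrows `L_β(g) = β(z) · g`, where `t(β(z)) = s(g)`; it is defined on arrows
with source in `β.base.target`. -/
def leftTrans (β : LocalBisection 𝒢) (g : G) : G :=
  𝒢.mul (β.toFun (β.base.symm (𝒢.src g))) g

/-- Right translation of arrows `R_β(g) = g · β(t(g))`; it is defined on arrows with target in
`β.base.source`. -/
def rightTrans (β : LocalBisection 𝒢) (g : G) : G :=
  𝒢.mul g (β.toFun (𝒢.tgt g))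

/-- Conjugation of arrows by a local bisection, `g ↦ β · g · β⁻¹`. -/
def conj (β : LocalBisection 𝒢) (g : G) : G := β.leftTrans (β.inv.rightTrans g)

theorem tgt_eq_src_left (β : LocalBisection 𝒢) {g : G} (hg : 𝒢.src g ∈ β.base.target) :
    𝒢.tgt (β.toFun (β.base.symm (𝒢.src g))) = 𝒢.src g := by
  rw [β.tgt_toFun _ (β.base.map_target hg), β.base.right_inv hg]

theorem src_leftTrans (β : LocalBisection 𝒢) {g : G} (hg : 𝒢.src g ∈ β.base.target) :
    𝒢.src (β.leftTrans g) = β.base.symm (𝒢.src g) := by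
  rw [leftTrans, 𝒢.src_mul _ _ (β.tgt_eq_src_left hg), β.src_toFun _ (β.base.map_target hg)]

theorem src_rightTrans (β : LocalBisection 𝒢) {g : G} (hg : 𝒢.tgt g ∈ β.base.source) :
    𝒢.src (β.rightTrans g) = 𝒢.src g := by
  rw [rightTrans, 𝒢.src_mul _ _ (β.src_toFun _ hg).symm]

theorem contMDiffAt_leftTrans (β : LocalBisection 𝒢) {g : G} (hg : 𝒢.src g ∈ β.base.target) :
    ContMDiffAt 𝓘(ℝ, EG) 𝓘(ℝ, EG) ∞ β.leftTrans g := by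
  have ho : IsOpen (𝒢.src ⁻¹' β.base.target) :=
    β.base.open_target.preimage 𝒢.smooth_src.continuous
  have h1 : ContMDiffOn 𝓘(ℝ, EG) 𝓘(ℝ, EG) ∞ (fun k => β.toFun (β.base.symm (𝒢.src k)))
      (𝒢.src ⁻¹' β.base.target) :=
    (β.smooth_toFun.comp β.smooth_base_symm fun _ hy => β.base.map_target hy).comp
      𝒢.smooth_src.contMDiffOn fun _ hk => hk
  have h2 : ContMDiffOn 𝓘(ℝ, EG) 𝓘(ℝ, EG) ∞ β.leftTrans (𝒢.src ⁻¹' β.base.target) :=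
    𝒢.smooth_mul.comp (h1.prodMk contMDiffOn_id) fun k hk => β.tgt_eq_src_left hk
  exact h2.contMDiffAt (ho.mem_nhds hg)

theorem contMDiffAt_rightTrans (β : LocalBisection 𝒢) {g : G} (hg : 𝒢.tgt g ∈ β.base.source) :
    ContMDiffAt 𝓘(ℝ, EG) 𝓘(ℝ, EG) ∞ β.rightTrans g := by
  have ho : IsOpen (𝒢.tgt ⁻¹' β.base.source) :=
    β.base.open_source.preimage 𝒢.smooth_tgt.continuous
  have h1 : ContMDiffOn 𝓘(ℝ, EG) 𝓘(ℝ, EG) ∞ (fun k => β.toFun (𝒢.tgt k))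
      (𝒢.tgt ⁻¹' β.base.source) :=
    β.smooth_toFun.comp 𝒢.smooth_tgt.contMDiffOn fun _ hk => hk
  have h2 : ContMDiffOn 𝓘(ℝ, EG) 𝓘(ℝ, EG) ∞ β.rightTrans (𝒢.tgt ⁻¹' β.base.source) :=
    𝒢.smooth_mul.comp (contMDiffOn_id.prodMk h1) fun k hk => (β.src_toFun _ hk).symm
  exact h2.contMDiffAt (ho.mem_nhds hg)

theorem inv_leftTrans_toFun (β : LocalBisection 𝒢) {x : G₀} (hx : x ∈ β.base.source) :
    β.inv.leftTrans (β.toFun x) = 𝒢.one (β.base x) := by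
  have h : β.inv.toFun (β.inv.base.symm (𝒢.src (β.toFun x))) = 𝒢.inv (β.toFun x) := by
    change 𝒢.inv (β.toFun (β.base.symm (β.base (𝒢.src (β.toFun x))))) = _
    rw [β.src_toFun x hx, β.base.left_inv hx]
  rw [leftTrans, h, 𝒢.inv_mul, β.tgt_toFun x hx]

theorem conj_one (β : LocalBisection 𝒢) {y : G₀} (hy : y ∈ β.base.target) :
    β.conj (𝒢.one y) = 𝒢.one (β.base.symm y) := by
  have hx := β.base.map_target hy
  have h1 : β.inv.rightTrans (𝒢.one y) = 𝒢.inv (β.toFun (β.base.symm y)) := by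
    have h := 𝒢.one_mul (𝒢.inv (β.toFun (β.base.symm y)))
    rw [𝒢.src_inv, β.tgt_toFun _ hx, β.base.right_inv hy] at h
    rw [rightTrans, 𝒢.tgt_one]
    exact h
  have h2 : 𝒢.src (𝒢.inv (β.toFun (β.base.symm y))) = y := by
    rw [𝒢.src_inv, β.tgt_toFun _ hx, β.base.right_inv hy]
  rw [conj, h1, leftTrans, h2, 𝒢.mul_inv, β.src_toFun _ hx]

theorem contMDiffAt_conj (β : LocalBisection 𝒢) {g : G} (hs : 𝒢.src g ∈ β.base.target)
    (ht : 𝒢.tgt g ∈ β.base.target) : ContMDiffAt 𝓘(ℝ, EG) 𝓘(ℝ, EG) ∞ β.conj g := by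
  have h : 𝒢.src (β.inv.rightTrans g) ∈ β.base.target := by
    rw [β.inv.src_rightTrans ht]
    exact hs
  exact (β.contMDiffAt_leftTrans h).comp g (β.inv.contMDiffAt_rightTrans ht)

/-- The adjoint action `Ad_β : A → A` of a local bisection `β`, over `(t ∘ β)⁻¹`: the derivative
at the units of the conjugation `g ↦ β · g · β⁻¹`. -/
def Ad (β : LocalBisection 𝒢) (y : β.base.target) : 𝒢.alg y →ₗ[ℝ] 𝒢.alg (β.base.symm y) :=
  LinearMap.restrict
    (show TangentSpace 𝓘(ℝ, EG) (𝒢.one y) →ₗ[ℝ] TangentSpace 𝓘(ℝ, EG) (𝒢.one (β.base.symm y)) from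
      (mfderiv 𝓘(ℝ, EG) 𝓘(ℝ, EG) β.conj (𝒢.one y)).toLinearMap)
    fun v hv => by
      have hs : 𝒢.src (𝒢.one y) ∈ β.base.target := by rw [𝒢.src_one]; exact y.2
      have ht : 𝒢.tgt (𝒢.one y) ∈ β.base.target := by rw [𝒢.tgt_one]; exact y.2
      refine 𝒢.mem_alg_of_eq (β.conj_one y.2) (𝒢.mfderiv_mem_srcKer (ψ := β.base.symm)
        ((β.contMDiffAt_conj hs ht).mdifferentiableAt (by simp))
        ((β.smooth_base_symm.contMDiffAt
          (β.base.open_target.mem_nhds hs)).mdifferentiableAt (by simp)) ?_ hv)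
      filter_upwards [(β.base.open_target.preimage 𝒢.smooth_src.continuous).mem_nhds hs,
        (β.base.open_target.preimage 𝒢.smooth_tgt.continuous).mem_nhds ht] with k hks hkt
      have h : 𝒢.src (β.inv.rightTrans k) = 𝒢.src k := β.inv.src_rightTrans hkt
      rw [conj, β.src_leftTrans (by rw [h]; exact hks), h]

/-- The adjoint action `Ad_{β⁻¹} : A → A` of the inverse of a local bisection `β`, over `t ∘ β`. -/
def AdInv (β : LocalBisection 𝒢) (x : β.base.source) : 𝒢.alg x →ₗ[ℝ] 𝒢.alg (β.base x) :=
  β.inv.Ad x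

/-- The tangent space `T_β 𝓑(G) = Γ(β^* T^s G)` of the bisections at `β`: fields of vectors along
`β` which are tangent to the source fibres. -/
abbrev Tangent (β : LocalBisection 𝒢) : Type _ := ∀ x : β.base.source, 𝒢.srcKer (β.toFun x)

/-- The Maurer-Cartan form `(β, 𝒳) ↦ (L_β⁻¹)_* 𝒳` of the bisections; its value is a section of `A`
over the open set `β.base.target`. -/
def maurerCartan (β : LocalBisection 𝒢) (X : β.Tangent) (y : β.base.target) : 𝒢.alg y :=
  ⟨show TangentSpace 𝓘(ℝ, EG) (𝒢.one y) from
      mfderiv 𝓘(ℝ, EG) 𝓘(ℝ, EG) β.inv.leftTrans (β.toFun (β.base.symm y))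
        (X ⟨β.base.symm y, β.base.map_target y.2⟩).1, by
    have hx : β.base.symm y ∈ β.base.source := β.base.map_target y.2
    have hs : 𝒢.src (β.toFun (β.base.symm y)) ∈ β.inv.base.target := by
      rw [β.src_toFun _ hx]; exact hx
    have h1 : β.inv.leftTrans (β.toFun (β.base.symm y)) = 𝒢.one y := by
      rw [β.inv_leftTrans_toFun hx, β.base.right_inv y.2]
    refine 𝒢.mem_alg_of_eq h1 (𝒢.mfderiv_mem_srcKer (ψ := β.base)
      ((β.inv.contMDiffAt_leftTrans hs).mdifferentiableAt (by simp))
      ((β.smooth_base.contMDiffAt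
        (β.base.open_source.mem_nhds hs)).mdifferentiableAt (by simp)) ?_
      (X ⟨β.base.symm y, hx⟩).2)
    filter_upwards [(β.base.open_source.preimage 𝒢.smooth_src.continuous).mem_nhds hs] with k hk
    exact β.inv.src_leftTrans hk⟩

end LocalBisection

section

variable {EM M : Type*} [NormedAddCommGroup EM] [NormedSpace ℝ EM]
  [TopologicalSpace M] [ChartedSpace EM M]

/-- A smooth map `γ ∈ C^∞(M, 𝓑(G))` from `M` to the local bisections of `G`: the set of the pairs
`(m, x)` where `γ(m)` is defined at `x` is open, and `(m, x) ↦ γ(m)(x)` is smooth on it. -/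
structure BisectionMap (EM M : Type*) [NormedAddCommGroup EM] [NormedSpace ℝ EM]
    [TopologicalSpace M] [ChartedSpace EM M] (𝒢 : LieGroupoid EG E₀ G G₀) where
  toFun : M → LocalBisection 𝒢
  isOpen_domain : IsOpen {q : M × G₀ | q.2 ∈ (toFun q.1).base.source}
  smooth_toFun : ContMDiffOn (𝓘(ℝ, EM).prod 𝓘(ℝ, E₀)) 𝓘(ℝ, EG) ∞
    (fun q : M × G₀ => (toFun q.1).toFun q.2) {q | q.2 ∈ (toFun q.1).base.source}

variable {𝒢 : LieGroupoid EG E₀ G G₀}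

/-- The differential `γ_* : T_m M → T_{γ(m)} 𝓑(G)`; the field `γ_* X` along `γ(m)` has at `x` the
derivative of `m' ↦ γ(m')(x)` in the direction `X`. -/
def BisectionMap.tangentMap (γ : BisectionMap EM M 𝒢) (m : M) (X : TangentSpace 𝓘(ℝ, EM) m) :
    (γ.toFun m).Tangent := fun x =>
  ⟨mfderiv 𝓘(ℝ, EM) 𝓘(ℝ, EG) (fun m' => (γ.toFun m').toFun x) m X, by
    have hx : ((m, (x : G₀)) : M × G₀) ∈ {q : M × G₀ | q.2 ∈ (γ.toFun q.1).base.source} := x.2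
    have h0 : ContMDiffAt 𝓘(ℝ, EM) (𝓘(ℝ, EM).prod 𝓘(ℝ, E₀)) ∞ (fun m' : M => (m', (x : G₀))) m :=
      contMDiffAt_id.prodMk contMDiffAt_const
    have h1 : ContMDiffAt 𝓘(ℝ, EM) 𝓘(ℝ, EG) ∞ (fun m' => (γ.toFun m').toFun x) m :=
      (γ.smooth_toFun.contMDiffAt (γ.isOpen_domain.mem_nhds hx)).comp m h0
    have h2 : 𝒢.src ∘ (fun m' => (γ.toFun m').toFun x) =ᶠ[𝓝 m] fun _ => (x : G₀) := by
      filter_upwards [h0.continuousAt.preimage_mem_nhds (γ.isOpen_domain.mem_nhds hx)] with m' hm'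
      exact (γ.toFun m').src_toFun _ hm'
    have h3 := mfderiv_comp_apply m (𝒢.smooth_src.mdifferentiableAt (by simp))
      (h1.mdifferentiableAt (by simp)) X
    have h4 := h2.mfderiv_eq.trans (mfderiv_const (I := 𝓘(ℝ, EM)) (I' := 𝓘(ℝ, E₀)))
    exact h3.symm.trans (congrArg (fun L : EM →L[ℝ] E₀ => L X) h4)⟩

/-- The pullback `γ⁻¹γ'` of the Maurer-Cartan form by `γ`, at `m ∈ M` and evaluated at the point of
`G₀` to which `γ(m)` sends `x`. -/
def BisectionMap.pullbackMC (γ : BisectionMap EM M 𝒢) (m : M) (x : (γ.toFun m).base.source)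
    (X : TangentSpace 𝓘(ℝ, EM) m) : 𝒢.alg ((γ.toFun m).base x) :=
  (γ.toFun m).maurerCartan (γ.tangentMap m X) ⟨(γ.toFun m).base x, (γ.toFun m).base.map_source x.2⟩

end

end

section

variable {EP EM P M : Type*} [NormedAddCommGroup EP] [NormedSpace ℝ EP]
  [NormedAddCommGroup EM] [NormedSpace ℝ EM] [TopologicalSpace P] [ChartedSpace EP P]
  [TopologicalSpace M] [ChartedSpace EM M]

/-- A vector in the kernel of the differential of a submersion is the velocity of a curve in the
fibre. -/
theorem exists_curve_in_fibre [IsManifold 𝓘(ℝ, EP) ∞ P] [IsManifold 𝓘(ℝ, EM) ∞ M] {π : P → M}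
    {p : P} (hπ : Manifold.IsSubmersionAt 𝓘(ℝ, EP) 𝓘(ℝ, EM) ∞ π p)
    {v : TangentSpace 𝓘(ℝ, EP) p} (hv : mfderiv 𝓘(ℝ, EP) 𝓘(ℝ, EM) π p v = 0) :
    ∃ c : ℝ → P, c 0 = p ∧ (∀ᶠ τ in 𝓝 (0 : ℝ), π (c τ) = π p) ∧
      MDifferentiableAt 𝓘(ℝ, ℝ) 𝓘(ℝ, EP) c 0 ∧
      (show EP from mfderiv 𝓘(ℝ, ℝ) 𝓘(ℝ, EP) c 0 (1 : ℝ)) = v := by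
  let φ := hπ.domChart
  let ψ := hπ.codChart
  let w : EP := mfderiv 𝓘(ℝ, EP) 𝓘(ℝ, EP) φ p v
  have hp : p ∈ φ.source := hπ.mem_domChart_source
  have hφ : MDifferentiableAt 𝓘(ℝ, EP) 𝓘(ℝ, EP) φ p :=
    ((contMDiffOn_of_mem_maximalAtlas hπ.domChart_mem_maximalAtlas).contMDiffAt
      (φ.open_source.mem_nhds hp)).mdifferentiableAt (by simp)
  have hφs : MDifferentiableAt 𝓘(ℝ, EP) 𝓘(ℝ, EP) φ.symm (φ p) :=
    ((contMDiffOn_symm_of_mem_maximalAtlas hπ.domChart_mem_maximalAtlas).contMDiffAt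
      (φ.open_target.mem_nhds (φ.map_source hp))).mdifferentiableAt (by simp)
  have hψ : MDifferentiableAt 𝓘(ℝ, EM) 𝓘(ℝ, EM) ψ (π p) :=
    ((contMDiffOn_of_mem_maximalAtlas hπ.codChart_mem_maximalAtlas).contMDiffAt
      (ψ.open_source.mem_nhds hπ.mem_codChart_source)).mdifferentiableAt (by simp)
  have hπd : MDifferentiableAt 𝓘(ℝ, EP) 𝓘(ℝ, EM) π p := hπ.contMDiffAt.mdifferentiableAt (by simp)
  have hw : ∀ z ∈ φ.target, ψ (π (φ.symm z)) = (hπ.equiv z).1 := fun z hz => by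
    have hz' : z ∈ (hπ.domChart.extend 𝓘(ℝ, EP)).target := by simpa using hz
    simpa using hπ.writtenInCharts hz'
  -- the chart expression shows that `w` has no component along the base
  have hw0 : (hπ.equiv w).1 = 0 := by
    let L : EP →L[ℝ] EM :=
      (ContinuousLinearMap.fst ℝ EM hπ.complement).comp (hπ.equiv : EP →L[ℝ] EM × hπ.complement)
    have h1 : ψ ∘ π =ᶠ[𝓝 p] L ∘ φ := by
      filter_upwards [φ.open_source.mem_nhds hp] with q hq
      have := hw (φ q) (φ.map_source hq)
      rw [φ.left_inv hq] at this
      exact this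
    have h2 := mfderiv_comp_apply p hψ hπd v
    have hL : MDifferentiableAt 𝓘(ℝ, EP) 𝓘(ℝ, EM) L (φ p) := L.differentiableAt.mdifferentiableAt
    have h3 := mfderiv_comp_apply p hL hφ v
    have h4 : mfderiv 𝓘(ℝ, EP) 𝓘(ℝ, EM) L (φ p) = L := by
      rw [mfderiv_eq_fderiv]; exact L.fderiv
    have h5 := congrArg (fun A : EP →L[ℝ] EM => A v) (h1.mfderiv_eq (I := 𝓘(ℝ, EP)) (I' := 𝓘(ℝ, EM)))
    have h6 : (mfderiv 𝓘(ℝ, EM) 𝓘(ℝ, EM) ψ (π p)) (mfderiv 𝓘(ℝ, EP) 𝓘(ℝ, EM) π p v) = 0 := by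
      rw [hv, map_zero]
    have h7 : L w = 0 :=
      (congrArg (fun A : EP →L[ℝ] EM => A w) h4).symm.trans
        (h3.symm.trans (h5.symm.trans (h2.trans h6)))
    exact h7
  let ℓ : ℝ → EP := fun τ => φ p + τ • w
  have hℓ : HasFDerivAt ℓ ((ContinuousLinearMap.id ℝ ℝ).smulRight w) 0 :=
    ((ContinuousLinearMap.id ℝ ℝ).smulRight w).hasFDerivAt.const_add _
  have hℓ0 : ℓ 0 = φ p := by simp [ℓ]
  have hℓd : MDifferentiableAt 𝓘(ℝ, ℝ) 𝓘(ℝ, EP) ℓ 0 := hℓ.differentiableAt.mdifferentiableAt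
  have hφs' : MDifferentiableAt 𝓘(ℝ, EP) 𝓘(ℝ, EP) φ.symm (ℓ 0) := by rw [hℓ0]; exact hφs
  refine ⟨φ.symm ∘ ℓ, ?_, ?_, hφs'.comp 0 hℓd, ?_⟩
  · simp [hℓ0, φ.left_inv hp]
  · have hc : Filter.Tendsto ℓ (𝓝 0) (𝓝 (φ p)) := hℓ0 ▸ hℓ.continuousAt
    have hc' : Filter.Tendsto (fun τ => π (φ.symm (ℓ τ))) (𝓝 0) (𝓝 (π p)) := by
      have h1 : ContinuousAt φ.symm (φ p) := hφs.continuousAt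
      have h2 : Filter.Tendsto φ.symm (𝓝 (φ p)) (𝓝 p) := by
        simpa [φ.left_inv hp] using h1.tendsto
      exact (hπd.continuousAt.tendsto.comp h2).comp hc
    filter_upwards [hc (φ.open_target.mem_nhds (φ.map_source hp)),
      hc' (ψ.open_source.mem_nhds hπ.mem_codChart_source)] with τ h1 h2
    refine ψ.injOn h2 hπ.mem_codChart_source ?_
    have h3 := hw _ h1
    have h4 := hw _ (φ.map_source hp)
    rw [φ.left_inv hp] at h4
    change ψ (π (φ.symm (ℓ τ))) = ψ (π p)
    rw [h3, h4]
    simp [ℓ, hw0]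
  · have h1 := mfderiv_comp_apply 0 hφs' hℓd (1 : ℝ)
    have h2 : (mfderiv 𝓘(ℝ, ℝ) 𝓘(ℝ, EP) ℓ 0) = ((ContinuousLinearMap.id ℝ ℝ).smulRight w) := by
      rw [mfderiv_eq_fderiv]; exact hℓ.fderiv
    have h3 : (show EP from mfderiv 𝓘(ℝ, ℝ) 𝓘(ℝ, EP) ℓ 0 (1 : ℝ)) = w :=
      (congrArg (fun A : ℝ →L[ℝ] EP => A 1) h2).trans (by simp)
    have h4 : φ.symm ∘ φ =ᶠ[𝓝 p] id := by
      filter_upwards [φ.open_source.mem_nhds hp] with q hq using φ.left_inv hq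
    have h5 := congrArg (fun A : EP →L[ℝ] EP => A v) (h4.mfderiv_eq.trans
      (mfderiv_id (I := 𝓘(ℝ, EP)) (x := p)))
    have h6 := mfderiv_comp_apply p hφs hφ v
    have h7 : (show EP from mfderiv 𝓘(ℝ, EP) 𝓘(ℝ, EP) φ.symm (ℓ 0) w) =
        (show EP from mfderiv 𝓘(ℝ, EP) 𝓘(ℝ, EP) φ.symm (φ p) w) := by rw [hℓ0]
    exact h1.trans ((congrArg (fun u : EP =>
      (show EP from mfderiv 𝓘(ℝ, EP) 𝓘(ℝ, EP) φ.symm (ℓ 0) u)) h3).trans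
        (h7.trans (h6.symm.trans h5)))

end

section

variable {EG E₀ G G₀ : Type*}
  [NormedAddCommGroup EG] [NormedSpace ℝ EG] [NormedAddCommGroup E₀] [NormedSpace ℝ E₀]
  [TopologicalSpace G] [ChartedSpace EG G] [TopologicalSpace G₀] [ChartedSpace E₀ G₀]

/-- A principal groupoid bundle `π = proj : P → M` with structure groupoid `𝒢` and moment map
`ε = mom : P → G₀`. The right action `act p g = p · g` is a smooth map on the fibred product
`{(p, g) | mom p = src g}`. The field `div` is the division map: its fields say that
`(p, g) ↦ (p, p · g)` is a diffeomorphism from this fibred product onto `P ×_π P`, with the smooth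
inverse `(p, q) ↦ (p, div p q)`. The values of `act` and `div` outside of these fibred products
carry no information. The projection is a surjective submersion, as for the unit bundle
`src : G → G₀`; no local product structure is asked for. -/
structure PrincipalBundle (EP EM P M : Type*) [NormedAddCommGroup EP] [NormedSpace ℝ EP]
    [NormedAddCommGroup EM] [NormedSpace ℝ EM] [TopologicalSpace P] [ChartedSpace EP P]
    [TopologicalSpace M] [ChartedSpace EM M] (𝒢 : LieGroupoid EG E₀ G G₀) where
  proj : P → M
  mom : P → G₀
  act : P → G → P
  div : P → P → G
  submersion_proj : Manifold.IsSubmersion 𝓘(ℝ, EP) 𝓘(ℝ, EM) ∞ proj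
  surjective_proj : Function.Surjective proj
  smooth_mom : ContMDiff 𝓘(ℝ, EP) 𝓘(ℝ, E₀) ∞ mom
  smooth_act : ContMDiffOn (𝓘(ℝ, EP).prod 𝓘(ℝ, EG)) 𝓘(ℝ, EP) ∞
    (fun q : P × G => act q.1 q.2) {q | mom q.1 = 𝒢.src q.2}
  proj_act : ∀ p g, mom p = 𝒢.src g → proj (act p g) = proj p
  mom_act : ∀ p g, mom p = 𝒢.src g → mom (act p g) = 𝒢.tgt g
  act_one : ∀ p, act p (𝒢.one (mom p)) = p
  act_mul : ∀ p g h, mom p = 𝒢.src g → 𝒢.tgt g = 𝒢.src h →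
    act p (𝒢.mul g h) = act (act p g) h
  smooth_div : ContMDiffOn (𝓘(ℝ, EP).prod 𝓘(ℝ, EP)) 𝓘(ℝ, EG) ∞
    (fun q : P × P => div q.1 q.2) {q | proj q.1 = proj q.2}
  src_div : ∀ p q, proj p = proj q → 𝒢.src (div p q) = mom p
  act_div : ∀ p q, proj p = proj q → act p (div p q) = q
  div_act : ∀ p g, mom p = 𝒢.src g → div p (act p g) = g

variable {EP EM P M : Type*} [NormedAddCommGroup EP] [NormedSpace ℝ EP]
  [NormedAddCommGroup EM] [NormedSpace ℝ EM] [TopologicalSpace P] [ChartedSpace EP P]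
  [TopologicalSpace M] [ChartedSpace EM M]
  {𝒢 : LieGroupoid EG E₀ G G₀}

namespace PrincipalBundle

/-- The vertical space `ker π_* ⊆ T_p P`. -/
def vertical (B : PrincipalBundle EP EM P M 𝒢) (p : P) : Submodule ℝ (TangentSpace 𝓘(ℝ, EP) p) :=
  (mfderiv 𝓘(ℝ, EP) 𝓘(ℝ, EM) B.proj p).ker

theorem div_self (B : PrincipalBundle EP EM P M 𝒢) (p : P) : B.div p p = 𝒢.one (B.mom p) := by
  have h := B.div_act p (𝒢.one (B.mom p)) (𝒢.src_one _).symm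
  rwa [B.act_one] at h

/-- The differential at `p` of the division map `δ_p = div p` on the fibre of `P` through `p`, as a
map on the vertical space. -/
def divTangent [IsManifold 𝓘(ℝ, EP) ∞ P] [IsManifold 𝓘(ℝ, EM) ∞ M]
    (B : PrincipalBundle EP EM P M 𝒢) (p : P) : B.vertical p →ₗ[ℝ] 𝒢.alg (B.mom p) :=
  LinearMap.restrict
    (show TangentSpace 𝓘(ℝ, EP) p →ₗ[ℝ] TangentSpace 𝓘(ℝ, EG) (𝒢.one (B.mom p)) from
      (mfderivWithin 𝓘(ℝ, EP) 𝓘(ℝ, EG) (B.div p) {q | B.proj p = B.proj q} p).toLinearMap)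
    fun v hv => by
      refine 𝒢.mem_alg_of_eq (B.div_self p) ?_
      obtain ⟨c, hc0, hcπ, hcd, hcv⟩ := exists_curve_in_fibre (B.submersion_proj.isSubmersionAt p) hv
      subst hc0
      let S : Set P := {q | B.proj (c 0) = B.proj q}
      have hf : MDifferentiableWithinAt 𝓘(ℝ, EP) 𝓘(ℝ, EG) (B.div (c 0)) S (c 0) := by
        have h1 : ContMDiffOn 𝓘(ℝ, EP) 𝓘(ℝ, EG) ∞ (B.div (c 0)) S :=
          B.smooth_div.comp (contMDiffOn_const.prodMk contMDiffOn_id) fun q hq => hq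
        exact (h1 (c 0) rfl).mdifferentiableWithinAt (by simp)
      let T : Set ℝ := {τ | c τ ∈ S}
      have hT : T ∈ 𝓝 (0 : ℝ) := by
        filter_upwards [hcπ] with τ hτ using hτ.symm
      have h1 := (hf.hasMFDerivWithinAt.comp 0 (hcd.hasMFDerivAt.hasMFDerivWithinAt (s := T))
        fun τ hτ => hτ).hasMFDerivAt hT
      have h2 := (𝒢.smooth_src.mdifferentiableAt (by simp)).hasMFDerivAt.comp 0 h1
      have h3 : 𝒢.src ∘ (B.div (c 0) ∘ c) =ᶠ[𝓝 0] fun _ => B.mom (c 0) := by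
        filter_upwards [hT] with τ hτ using B.src_div _ _ hτ
      have h4 := h2.mfderiv.symm.trans (h3.mfderiv_eq.trans (mfderiv_const (I := 𝓘(ℝ, ℝ))
        (I' := 𝓘(ℝ, E₀))))
      have h5 := congrArg (fun A : ℝ →L[ℝ] E₀ => A 1) h4
      refine Eq.trans ?_ h5
      exact congrArg (fun u : EP => (show E₀ from mfderiv 𝓘(ℝ, EG) 𝓘(ℝ, E₀) 𝒢.src (B.div (c 0) (c 0))
        (mfderivWithin 𝓘(ℝ, EP) 𝓘(ℝ, EG) (B.div (c 0)) S (c 0) u))) hcv.symm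

/-- The tangent action `(R_g)_* v` of an arrow `g`, for a vector `v` at `p` with `ε_* v = 0` (so
that `(v, 0)` is tangent to the fibred product on which the action is defined): the differential of
the action in the direction `(v, 0)`. -/
def actTangent (B : PrincipalBundle EP EM P M 𝒢) (p : P) (g : G) :
    TangentSpace 𝓘(ℝ, EP) p →ₗ[ℝ] TangentSpace 𝓘(ℝ, EP) (B.act p g) :=
  ((show EP × EG →L[ℝ] EP from mfderivWithin (𝓘(ℝ, EP).prod 𝓘(ℝ, EG)) 𝓘(ℝ, EP)
    (fun q : P × G => B.act q.1 q.2) {q | B.mom q.1 = 𝒢.src q.2} (p, g)).comp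
      (ContinuousLinearMap.inl ℝ EP EG)).toLinearMap

end PrincipalBundle

variable [IsManifold 𝓘(ℝ, EP) ∞ P]

/-- A horizontal distribution `TP = ker π_* ⊕ H`. That `H` is a smooth subbundle of `TP` is said
through the projection of `TP` onto `H` along `ker π_*`: it takes smooth vector fields to smooth
vector fields. -/
structure HorizontalDistribution (B : PrincipalBundle EP EM P M 𝒢) where
  space : ∀ p : P, Submodule ℝ (TangentSpace 𝓘(ℝ, EP) p)
  isCompl : ∀ p, IsCompl (B.vertical p) (space p)
  smooth : ∀ (X : ∀ p : P, TangentSpace 𝓘(ℝ, EP) p) (p : P),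
    ContMDiffAt 𝓘(ℝ, EP) (𝓘(ℝ, EP).prod 𝓘(ℝ, EP)) ∞
      (fun q => (⟨q, X q⟩ : TangentBundle 𝓘(ℝ, EP) P)) p →
    ContMDiffAt 𝓘(ℝ, EP) (𝓘(ℝ, EP).prod 𝓘(ℝ, EP)) ∞
      (fun q => (⟨q, (space q).projection (B.vertical q) (isCompl q).symm (X q)⟩ :
        TangentBundle 𝓘(ℝ, EP) P)) p

namespace HorizontalDistribution

variable {B : PrincipalBundle EP EM P M 𝒢}

/-- The horizontal part of a tangent vector. -/
def hor (H : HorizontalDistribution B) (p : P) :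
    TangentSpace 𝓘(ℝ, EP) p →ₗ[ℝ] TangentSpace 𝓘(ℝ, EP) p :=
  (H.space p).projection (B.vertical p) (H.isCompl p).symm

/-- The vertical part of a tangent vector. -/
def ver (H : HorizontalDistribution B) (p : P) :
    TangentSpace 𝓘(ℝ, EP) p →ₗ[ℝ] B.vertical p :=
  (B.vertical p).projectionOnto (H.space p) (H.isCompl p)

/-- The connection 1-form `α(X_p) = (δ_p)_* Ver(X_p)`, with values in `ε^* A`. -/
def connectionForm [IsManifold 𝓘(ℝ, EM) ∞ M]
    (H : HorizontalDistribution B) (p : P) :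
    TangentSpace 𝓘(ℝ, EP) p →ₗ[ℝ] 𝒢.alg (B.mom p) :=
  B.divTangent p ∘ₗ H.ver p

/-- The expression `-Ver [Hor X, Hor Y]` at `p`, for two vector fields on `P`. -/
def curvatureField (H : HorizontalDistribution B) (X Y : ∀ p : P, TangentSpace 𝓘(ℝ, EP) p)
    (p : P) : B.vertical p :=
  -H.ver p (VectorField.mlieBracket 𝓘(ℝ, EP) (fun q => H.hor q (X q)) (fun q => H.hor q (Y q)) p)

/-- The Ehresmann curvature `ω(u, v) = -Ver [Hor ũ, Hor ṽ]`, where `ũ`, `ṽ` are vector fields with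
the values `u`, `v` at `p`; here they are those with constant coefficients in the chart at `p`. -/
def ehresmannCurvature (H : HorizontalDistribution B) (p : P)
    (u v : TangentSpace 𝓘(ℝ, EP) p) : B.vertical p :=
  H.curvatureField (FiberBundle.extend EP u) (FiberBundle.extend EP v) p

theorem ver_of_mem (H : HorizontalDistribution B) {p : P} {v : TangentSpace 𝓘(ℝ, EP) p}
    (hv : v ∈ H.space p) : H.ver p v = 0 :=
  Submodule.projectionOnto_apply_right (H.isCompl p) ⟨v, hv⟩

theorem hor_mem (H : HorizontalDistribution B) (p : P) (v : TangentSpace 𝓘(ℝ, EP) p) :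
    H.hor p v ∈ H.space p :=
  Submodule.projection_apply_mem (H.isCompl p).symm v

theorem mdifferentiableAt_hor [FiniteDimensional ℝ EP] (H : HorizontalDistribution B)
    {X : ∀ p : P, TangentSpace 𝓘(ℝ, EP) p} {p : P} (hX : MDiffAt (T% X) p) :
    MDiffAt (T% (fun q => H.hor q (X q))) p := by
  let e := trivializationAt EP (TangentSpace 𝓘(ℝ, EP)) p
  have hp : p ∈ e.baseSet := FiberBundle.mem_baseSet_trivializationAt' p
  let b := Module.finBasis ℝ EP
  have h1 : ∀ i, MDiffAt (T% (fun q => H.hor q (e.localFrame b i q))) p := fun i =>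
    (H.smooth _ p (contMDiffAt_localFrame_of_mem ∞ e b i hp)).mdifferentiableAt (by simp)
  have h2 : ∀ i, MDiffAt (fun q => e.localFrameCoeff 𝓘(ℝ, EP) b i q (X q)) p := fun i =>
    mdifferentiableAt_localFrameCoeff b hp hX i
  have h3 : MDiffAt (T% (fun q => ∑ i, e.localFrameCoeff 𝓘(ℝ, EP) b i q (X q) •
      H.hor q (e.localFrame b i q))) p :=
    MDifferentiableAt.sum_section fun i _ => (h2 i).smul_section (h1 i)
  refine h3.congr_of_eventuallyEq ?_
  filter_upwards [e.open_baseSet.mem_nhds hp] with q hq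
  have h4 : X q = _ := e.eq_sum_localFrameCoeff_smul (I := 𝓘(ℝ, EP)) (b := b) (s := X) hq
  have h5 := congrArg (H.hor q) h4
  rw [map_sum] at h5
  simp only [map_smul] at h5
  exact congrArg (Bundle.TotalSpace.mk q) h5

/-- The value `-Ver [Hor X, Hor Y]` at `p` depends only on the values of `X` and `Y` at `p`, so the
Ehresmann curvature can be computed with any vector fields with the given values. -/
theorem curvatureField_eq [FiniteDimensional ℝ EP] (H : HorizontalDistribution B)
    {X Y : ∀ p : P, TangentSpace 𝓘(ℝ, EP) p} {p : P} (hX : MDiffAt (T% X) p)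
    (hY : MDiffAt (T% Y) p) :
    H.curvatureField X Y p = H.ehresmannCurvature p (X p) (Y p) := by
  have hs : ∀ (Y X : ∀ p : P, TangentSpace 𝓘(ℝ, EP) p),
      H.curvatureField X Y p = - H.curvatureField Y X p := fun Y X => by
    simp only [curvatureField]
    rw [VectorField.mlieBracket_swap_apply, map_neg]
  have h1 : ∀ Y : ∀ p : P, TangentSpace 𝓘(ℝ, EP) p, MDiffAt (T% Y) p →
      TensorialAt 𝓘(ℝ, EP) EP (fun X => H.curvatureField X Y p) p := fun Y hY =>
    { smul := fun {f X} hf hX => by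
        have h := VectorField.mlieBracket_smul_left (W := fun q => H.hor q (Y q)) hf
          (H.mdifferentiableAt_hor hX)
        have h' : (fun q => H.hor q ((f • X) q)) = f • fun q => H.hor q (X q) := by
          funext q
          exact map_smul (H.hor q) (f q) (X q)
        simp only [curvatureField]
        rw [h', h, map_add, map_smul, map_smul, H.ver_of_mem (H.hor_mem p (X p))]
        simp
      add := fun {X X'} hX hX' => by
        have h := VectorField.mlieBracket_add_left (W := fun q => H.hor q (Y q))
          (H.mdifferentiableAt_hor hX) (H.mdifferentiableAt_hor hX')
        have h' : (fun q => H.hor q ((X + X') q)) =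
            (fun q => H.hor q (X q)) + fun q => H.hor q (X' q) := by
          funext q
          exact map_add (H.hor q) (X q) (X' q)
        simp only [curvatureField]
        rw [h', h, map_add, neg_add] }
  have h2 : ∀ X : ∀ p : P, TangentSpace 𝓘(ℝ, EP) p, MDiffAt (T% X) p →
      TensorialAt 𝓘(ℝ, EP) EP (fun Y => H.curvatureField X Y p) p := fun X hX =>
    { smul := fun {f Y} hf hY => by
        rw [hs, (h1 X hX).smul hf hY, hs Y X, smul_neg]
      add := fun {Y Y'} hY hY' => by
        rw [hs, (h1 X hX).add hY hY', hs Y X, hs Y' X, neg_add] }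
  exact TensorialAt.pointwise₂ (Φ := fun X Y => H.curvatureField X Y p) h1 h2 hX
    (FiberBundle.mdifferentiableAt_extend ..) hY (FiberBundle.mdifferentiableAt_extend ..)
    (by simp) (by simp)

/-- The curvature 2-form `Ω` with values in `ε^* A`: the Ehresmann curvature, with the vertical
space at `p` identified with `A_{ε(p)}` by the action. -/
def curvature [IsManifold 𝓘(ℝ, EM) ∞ M]
    (H : HorizontalDistribution B) (p : P) (u v : TangentSpace 𝓘(ℝ, EP) p) : 𝒢.alg (B.mom p) :=
  B.divTangent p (H.ehresmannCurvature p u v)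

end HorizontalDistribution

/-- A principal connection: a horizontal distribution with `ε_* H = 0` and `H_{pg} = (R_g)_* H_p`. -/
structure PrincipalConnection (B : PrincipalBundle EP EM P M 𝒢) extends
    HorizontalDistribution B where
  mom_space : ∀ p, ∀ v ∈ space p, mfderiv 𝓘(ℝ, EP) 𝓘(ℝ, E₀) B.mom p v = 0
  map_space : ∀ p g, B.mom p = 𝒢.src g → space (B.act p g) = (space p).map (B.actTangent p g)

/-- A smooth section of `P → M` over an open subset `U` of `M`; its values outside `U` carry no
information. -/
structure LocalSection (B : PrincipalBundle EP EM P M 𝒢) (U : TopologicalSpace.Opens M) where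
  toFun : M → P
  smooth_toFun : ContMDiffOn 𝓘(ℝ, EM) 𝓘(ℝ, EP) ∞ toFun U
  proj_toFun : ∀ m ∈ U, B.proj (toFun m) = m

namespace LocalSection

variable {B : PrincipalBundle EP EM P M 𝒢} {U : TopologicalSpace.Opens M}

/-- The map `ε_σ = ε ∘ σ`. -/
def mom (σ : LocalSection B U) (m : M) : G₀ := B.mom (σ.toFun m)

/-- The section `σ · γ : m ↦ σ(m) · γ(m)(ε_σ(m))`, for a smooth family `γ` of local bisections such
that `γ(m)` is defined at `ε_σ(m)`. -/
def gauge (σ : LocalSection B U) (γ : BisectionMap EM M 𝒢)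
    (hγ : ∀ m ∈ U, σ.mom m ∈ (γ.toFun m).base.source) : LocalSection B U where
  toFun m := B.act (σ.toFun m) ((γ.toFun m).toFun (σ.mom m))
  smooth_toFun := by
    have h1 : ContMDiffOn 𝓘(ℝ, EM) 𝓘(ℝ, E₀) ∞ σ.mom U :=
      B.smooth_mom.comp_contMDiffOn σ.smooth_toFun
    have h2 : ContMDiffOn 𝓘(ℝ, EM) 𝓘(ℝ, EG) ∞ (fun m => (γ.toFun m).toFun (σ.mom m)) U :=
      γ.smooth_toFun.comp (contMDiffOn_id.prodMk h1) hγ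
    exact B.smooth_act.comp (σ.smooth_toFun.prodMk h2)
      fun m hm => ((γ.toFun m).src_toFun _ (hγ m hm)).symm
  proj_toFun m hm := by
    rw [B.proj_act _ _ ((γ.toFun m).src_toFun _ (hγ m hm)).symm, σ.proj_toFun m hm]

/-- The pullback `θ_σ = σ^* α` of the connection 1-form. -/
def form [IsManifold 𝓘(ℝ, EM) ∞ M] (σ : LocalSection B U)
    (H : HorizontalDistribution B) (m : M) (X : TangentSpace 𝓘(ℝ, EM) m) : 𝒢.alg (σ.mom m) :=
  H.connectionForm (σ.toFun m) (mfderiv 𝓘(ℝ, EM) 𝓘(ℝ, EP) σ.toFun m X)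

/-- The pullback `Ω_σ = σ^* Ω` of the curvature 2-form. -/
def curvature [IsManifold 𝓘(ℝ, EM) ∞ M] (σ : LocalSection B U)
    (H : HorizontalDistribution B) (m : M) (X Y : TangentSpace 𝓘(ℝ, EM) m) : 𝒢.alg (σ.mom m) :=
  H.curvature (σ.toFun m) (mfderiv 𝓘(ℝ, EM) 𝓘(ℝ, EP) σ.toFun m X)
    (mfderiv 𝓘(ℝ, EM) 𝓘(ℝ, EP) σ.toFun m Y)

end LocalSection

end

end

end GroupoidGauge

/-!
The gauge transformation is the product rule for `m ↦ R_{γ(m)}(σ(m))`, where a local bisection `β`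
acts on `P` by `R_β(p) = p · β(ε(p))`.

For a fixed `β`, the map `R_β` is a diffeomorphism between open sets of `P`, with inverse `R_{β⁻¹}`,
and `π ∘ R_β = π`, so its derivative preserves vertical vectors. On a horizontal vector `v` one has
`ε_* v = 0`, so the derivative of `β(ε(p))` drops out and `(R_β)_* v` is the tangent action of the
single arrow `β(ε(p))` (`mfderiv_rightTrans_eq_actTangent`); invariance of the connection then says
that `(R_β)_*` preserves horizontal vectors. Hence `(R_β)_*` commutes with `Hor` and `Ver`, and with
Lie brackets as well, so it preserves the Ehresmann curvature
(`ehresmannCurvature_mfderiv_rightTrans`). Since `δ(p · β(ε(p)), q · β(ε(q)))` is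
`β(ε(p))⁻¹ · δ(p, q) · β(ε(q))`, the identification of vertical spaces with fibres of `A` turns
`(R_β)_*` into `Ad_{β⁻¹}` (`divTangent_mfderiv_rightTrans`). Together these give
`(R_β)^* α = Ad_{β⁻¹} α` and `(R_β)^* Ω = Ad_{β⁻¹} Ω`.

By the product rule (`mfderiv_gauge`), `(σ · γ)_* X` is `(R_{γ(m)})_* σ_* X` plus the derivative of
`k ↦ R_{γ(k)}(σ(m))`. The latter is vertical: the curvature, a horizontal form, does not see it,
and `α` sends it to the Maurer-Cartan term, because `δ(p · g, p · k) = g⁻¹ · k`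
(`divTangent_mfderiv_rightTrans_left`).
-/

namespace GroupoidGauge

noncomputable section

section

variable {EG E₀ EP EM G G₀ P M : Type*}
  [NormedAddCommGroup EG] [NormedSpace ℝ EG] [NormedAddCommGroup E₀] [NormedSpace ℝ E₀]
  [TopologicalSpace G] [ChartedSpace EG G] [TopologicalSpace G₀] [ChartedSpace E₀ G₀]
  [NormedAddCommGroup EP] [NormedSpace ℝ EP]
  [NormedAddCommGroup EM] [NormedSpace ℝ EM] [TopologicalSpace P] [ChartedSpace EP P]
  [TopologicalSpace M] [ChartedSpace EM M]
  {𝒢 : LieGroupoid EG E₀ G G₀}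

/-! ### Groupoid identities -/

/-- Vectors over equal points are compared in the model space `EG`, which every tangent space of `G`
is by definition. -/
theorem LieGroupoid.Algebroid.ext {x y : G₀} (h : x = y) {a : 𝒢.alg x} {b : 𝒢.alg y}
    (hab : (show EG from a.1) = (show EG from b.1)) : (⟨x, a⟩ : 𝒢.Algebroid) = ⟨y, b⟩ := by
  subst h
  exact congrArg _ (Subtype.ext hab)

theorem LieGroupoid.inv_inv (𝒢 : LieGroupoid EG E₀ G G₀) (g : G) : 𝒢.inv (𝒢.inv g) = g := by
  have h1 : 𝒢.tgt (𝒢.inv (𝒢.inv g)) = 𝒢.src (𝒢.inv g) := 𝒢.tgt_inv _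
  have h2 := 𝒢.mul_assoc (𝒢.inv (𝒢.inv g)) (𝒢.inv g) g h1 (𝒢.tgt_inv g)
  rw [𝒢.inv_mul, 𝒢.inv_mul, 𝒢.tgt_inv, 𝒢.one_mul] at h2
  have h3 := 𝒢.mul_one (𝒢.inv (𝒢.inv g))
  rw [h1, 𝒢.src_inv] at h3
  rw [← h3, ← h2]

namespace LocalBisection

theorem inv_toFun_base (β : LocalBisection 𝒢) {x : G₀} (hx : x ∈ β.base.source) :
    β.inv.toFun (β.base x) = 𝒢.inv (β.toFun x) :=
  congrArg (fun y => 𝒢.inv (β.toFun y)) (β.base.left_inv hx)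

theorem inv_inv_toFun (β : LocalBisection 𝒢) {x : G₀} (hx : x ∈ β.base.source) :
    β.inv.inv.toFun x = β.toFun x := by
  change 𝒢.inv (β.inv.toFun (β.base x)) = _
  rw [β.inv_toFun_base hx, 𝒢.inv_inv]

/-- Conjugation by `β⁻¹` sends an arrow `k : x → y` to `β(x)⁻¹ · (k · β(y))`. -/
theorem inv_conj_apply (β : LocalBisection 𝒢) {k : G} (hs : 𝒢.src k ∈ β.base.source)
    (ht : 𝒢.tgt k ∈ β.base.source) :
    β.inv.conj k =
      𝒢.mul (𝒢.inv (β.toFun (𝒢.src k))) (𝒢.mul k (β.toFun (𝒢.tgt k))) := by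
  have h1 : β.inv.inv.rightTrans k = 𝒢.mul k (β.toFun (𝒢.tgt k)) := by
    rw [rightTrans, β.inv_inv_toFun ht]
  rw [conj, h1, leftTrans, 𝒢.src_mul _ _ (β.src_toFun _ ht).symm]
  exact congrArg (fun a => 𝒢.mul a _) (β.inv_toFun_base hs)

theorem inv_leftTrans_apply (β : LocalBisection 𝒢) {k : G} (hs : 𝒢.src k ∈ β.base.source) :
    β.inv.leftTrans k = 𝒢.mul (𝒢.inv (β.toFun (𝒢.src k))) k :=
  congrArg (fun a => 𝒢.mul a k) (β.inv_toFun_base hs)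

end LocalBisection

/-! ### The action of a local bisection on a principal bundle -/

namespace PrincipalBundle

variable (B : PrincipalBundle EP EM P M 𝒢)

/-- The action `R_β(p) = p · β(ε(p))` of a local bisection `β` on a principal bundle; it is defined
on `ε⁻¹(β.base.source)`. -/
def rightTrans (β : LocalBisection 𝒢) (p : P) : P := B.act p (β.toFun (B.mom p))

variable {B} {β : LocalBisection 𝒢} {p q : P}

theorem proj_rightTrans (hp : B.mom p ∈ β.base.source) :
    B.proj (B.rightTrans β p) = B.proj p :=
  B.proj_act _ _ (β.src_toFun _ hp).symm

theorem mom_rightTrans (hp : B.mom p ∈ β.base.source) :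
    B.mom (B.rightTrans β p) = β.base (B.mom p) :=
  (B.mom_act _ _ (β.src_toFun _ hp).symm).trans (β.tgt_toFun _ hp)

theorem act_act_inv {g : G} (h : B.mom p = 𝒢.src g) : B.act (B.act p g) (𝒢.inv g) = p := by
  rw [← B.act_mul p g _ h (𝒢.src_inv g).symm, 𝒢.mul_inv, ← h, B.act_one]

theorem rightTrans_inv_rightTrans (hp : B.mom p ∈ β.base.source) :
    B.rightTrans β.inv (B.rightTrans β p) = p := by
  rw [rightTrans, mom_rightTrans hp, β.inv_toFun_base hp]
  exact act_act_inv (β.src_toFun _ hp).symm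

theorem eventually_mom_mem (hp : B.mom p ∈ β.base.source) :
    ∀ᶠ q in 𝓝 p, B.mom q ∈ β.base.source :=
  B.smooth_mom.continuous.continuousAt.preimage_mem_nhds (β.base.open_source.mem_nhds hp)

theorem contMDiffAt_rightTrans (hp : B.mom p ∈ β.base.source) :
    ContMDiffAt 𝓘(ℝ, EP) 𝓘(ℝ, EP) ∞ (B.rightTrans β) p := by
  have h1 : ContMDiffOn 𝓘(ℝ, EP) 𝓘(ℝ, EG) ∞ (fun q => β.toFun (B.mom q))
      (B.mom ⁻¹' β.base.source) :=
    β.smooth_toFun.comp B.smooth_mom.contMDiffOn fun _ hk => hk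
  have h2 : ContMDiffOn 𝓘(ℝ, EP) 𝓘(ℝ, EP) ∞ (B.rightTrans β) (B.mom ⁻¹' β.base.source) :=
    B.smooth_act.comp (contMDiffOn_id.prodMk h1) fun k hk => (β.src_toFun _ hk).symm
  exact h2.contMDiffAt (eventually_mom_mem hp)

theorem mdifferentiableAt_rightTrans (hp : B.mom p ∈ β.base.source) :
    MDifferentiableAt 𝓘(ℝ, EP) 𝓘(ℝ, EP) (B.rightTrans β) p :=
  (contMDiffAt_rightTrans hp).mdifferentiableAt (by simp)

theorem mdifferentiableAt_proj : MDifferentiableAt 𝓘(ℝ, EP) 𝓘(ℝ, EM) B.proj p :=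
  (B.submersion_proj.isSubmersionAt p).contMDiffAt.mdifferentiableAt (by simp)

/-- The derivative of `R_{β⁻¹}` is an inverse of that of `R_β`. -/
theorem isInvertible_mfderiv_rightTrans [FiniteDimensional ℝ EP]
    (hp : B.mom p ∈ β.base.source) :
    (mfderiv 𝓘(ℝ, EP) 𝓘(ℝ, EP) (B.rightTrans β) p).IsInvertible := by
  have hp' : B.mom (B.rightTrans β p) ∈ β.inv.base.source := by
    rw [mom_rightTrans hp]
    exact β.base.map_source hp
  let A : EP →L[ℝ] EP := mfderiv 𝓘(ℝ, EP) 𝓘(ℝ, EP) (B.rightTrans β) p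
  let C : EP →L[ℝ] EP := mfderiv 𝓘(ℝ, EP) 𝓘(ℝ, EP) (B.rightTrans β.inv) (B.rightTrans β p)
  have h1 : B.rightTrans β.inv ∘ B.rightTrans β =ᶠ[𝓝 p] id := by
    filter_upwards [eventually_mom_mem hp] with q hq using rightTrans_inv_rightTrans hq
  have h2 : C.comp A = ContinuousLinearMap.id ℝ EP :=
    (mfderiv_comp p (mdifferentiableAt_rightTrans hp') (mdifferentiableAt_rightTrans hp)).symm.trans
      (h1.mfderiv_eq.trans mfderiv_id)
  have h3 : (C : EP →ₗ[ℝ] EP) * (A : EP →ₗ[ℝ] EP) = 1 :=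
    LinearMap.ext fun v => DFunLike.congr_fun h2 v
  have h4 : A.comp C = ContinuousLinearMap.id ℝ EP :=
    ContinuousLinearMap.ext fun v => DFunLike.congr_fun (mul_eq_one_comm.mp h3) v
  exact ContinuousLinearMap.IsInvertible.of_inverse (f := A) (g := C) h4 h2

/-- The division map turns `R_β` into the conjugation by `β⁻¹`. -/
theorem div_rightTrans (h : B.proj p = B.proj q) (hp : B.mom p ∈ β.base.source)
    (hq : B.mom q ∈ β.base.source) :
    B.div (B.rightTrans β p) (B.rightTrans β q) = β.inv.conj (B.div p q) := by
  have hs : 𝒢.src (B.div p q) = B.mom p := B.src_div p q h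
  have ht : 𝒢.tgt (B.div p q) = B.mom q := by
    rw [← B.mom_act p _ hs.symm, B.act_div p q h]
  have e1 : B.mom p = 𝒢.src (β.toFun (B.mom p)) := (β.src_toFun _ hp).symm
  have e2 : B.mom q = 𝒢.src (β.toFun (B.mom q)) := (β.src_toFun _ hq).symm
  have e3 : 𝒢.src (𝒢.mul (B.div p q) (β.toFun (B.mom q))) = B.mom p := by
    rw [𝒢.src_mul _ _ (ht.trans e2), hs]
  have e4 : 𝒢.tgt (𝒢.inv (β.toFun (B.mom p))) = B.mom p := by rw [𝒢.tgt_inv, ← e1]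
  have e5 : B.mom (B.act p (β.toFun (B.mom p))) = 𝒢.src (𝒢.inv (β.toFun (B.mom p))) := by
    rw [B.mom_act _ _ e1, 𝒢.src_inv]
  have key : B.rightTrans β q = B.act (B.rightTrans β p)
      (𝒢.mul (𝒢.inv (β.toFun (B.mom p))) (𝒢.mul (B.div p q) (β.toFun (B.mom q)))) := by
    rw [rightTrans, rightTrans, B.act_mul _ _ _ e5 (e4.trans e3.symm), act_act_inv e1,
      B.act_mul _ _ _ hs.symm (ht.trans e2), B.act_div p q h]
  rw [β.inv_conj_apply (by rwa [hs]) (by rwa [ht]), hs, ht, key]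
  refine B.div_act _ _ ?_
  rw [𝒢.src_mul _ _ (e4.trans e3.symm)]
  exact e5

/-- Division within the orbit of `p`: `δ(p · g, p · k) = g⁻¹ · k`. -/
theorem div_act_act {g k : G} (hg : B.mom p = 𝒢.src g) (hk : B.mom p = 𝒢.src k) :
    B.div (B.act p g) (B.act p k) = 𝒢.mul (𝒢.inv g) k := by
  have e1 : B.mom (B.act p g) = 𝒢.src (𝒢.inv g) := by rw [B.mom_act _ _ hg, 𝒢.src_inv]
  have e2 : 𝒢.tgt (𝒢.inv g) = 𝒢.src k := by rw [𝒢.tgt_inv, ← hg, hk]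
  have h := B.act_mul (B.act p g) (𝒢.inv g) k e1 e2
  rw [act_act_inv hg] at h
  rw [← h]
  exact B.div_act _ _ (by rw [𝒢.src_mul _ _ e2, e1])

theorem mfderiv_rightTrans_mem_vertical {v : TangentSpace 𝓘(ℝ, EP) p}
    (hp : B.mom p ∈ β.base.source) (hv : v ∈ B.vertical p) :
    mfderiv 𝓘(ℝ, EP) 𝓘(ℝ, EP) (B.rightTrans β) p v ∈ B.vertical (B.rightTrans β p) := by
  have h1 : B.proj ∘ B.rightTrans β =ᶠ[𝓝 p] B.proj := by
    filter_upwards [eventually_mom_mem hp] with q hq using proj_rightTrans hq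
  have h2 := mfderiv_comp_apply p (mdifferentiableAt_proj (B := B) (p := B.rightTrans β p))
    (mdifferentiableAt_rightTrans hp) v
  have h3 : (mfderiv 𝓘(ℝ, EP) 𝓘(ℝ, EM) (B.proj ∘ B.rightTrans β) p v : EM) =
      mfderiv 𝓘(ℝ, EP) 𝓘(ℝ, EM) B.proj p v :=
    congrArg (fun A : EP →L[ℝ] EM => A v) h1.mfderiv_eq
  exact h2.symm.trans (h3.trans hv)

/-- On a vector which is the derivative of a map into a fibre of the bundle, the derivative of the
division map within this fibre is given by the chain rule. The derivative within the fibre is not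
unique on all of `T_p P`, but it is on such vectors. -/
theorem divTangent_mfderiv [IsManifold 𝓘(ℝ, EP) ∞ P] [IsManifold 𝓘(ℝ, EM) ∞ M]
    {EN N : Type*} [NormedAddCommGroup EN] [NormedSpace ℝ EN] [TopologicalSpace N]
    [ChartedSpace EN N] {f : N → P} {n : N} (hf : MDifferentiableAt 𝓘(ℝ, EN) 𝓘(ℝ, EP) f n)
    (hfib : ∀ᶠ n' in 𝓝 n, B.proj (f n) = B.proj (f n')) (X : TangentSpace 𝓘(ℝ, EN) n)
    (hX : mfderiv 𝓘(ℝ, EN) 𝓘(ℝ, EP) f n X ∈ B.vertical (f n)) :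
    MDifferentiableAt 𝓘(ℝ, EN) 𝓘(ℝ, EG) (fun n' => B.div (f n) (f n')) n ∧
    (show EG from (B.divTangent (f n) ⟨_, hX⟩).1) =
      mfderiv 𝓘(ℝ, EN) 𝓘(ℝ, EG) (fun n' => B.div (f n) (f n')) n X := by
  let S : Set P := {q | B.proj (f n) = B.proj q}
  have hd : MDifferentiableWithinAt 𝓘(ℝ, EP) 𝓘(ℝ, EG) (B.div (f n)) S (f n) := by
    have h1 : ContMDiffOn 𝓘(ℝ, EP) 𝓘(ℝ, EG) ∞ (B.div (f n)) S :=
      B.smooth_div.comp (contMDiffOn_const.prodMk contMDiffOn_id) fun q hq => hq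
    exact (h1 (f n) rfl).mdifferentiableWithinAt (by simp)
  have h1 := (hd.hasMFDerivWithinAt.comp n (hf.hasMFDerivAt.hasMFDerivWithinAt (s := f ⁻¹' S))
    fun _ h => h).hasMFDerivAt hfib
  exact ⟨h1.mdifferentiableAt, (congrArg (fun A : EN →L[ℝ] EG => A X) h1.mfderiv).symm⟩

/-- The identification of the vertical spaces with the fibres of the Lie algebroid turns `(R_β)_*`
into `Ad_{β⁻¹}`. -/
theorem divTangent_mfderiv_rightTrans [IsManifold 𝓘(ℝ, EP) ∞ P] [IsManifold 𝓘(ℝ, EM) ∞ M]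
    {v : TangentSpace 𝓘(ℝ, EP) p} (hp : B.mom p ∈ β.base.source) (hv : v ∈ B.vertical p) :
    (show EG from (B.divTangent (B.rightTrans β p)
      ⟨_, mfderiv_rightTrans_mem_vertical hp hv⟩).1) =
      (show EG from (β.AdInv ⟨B.mom p, hp⟩ (B.divTangent p ⟨v, hv⟩)).1) := by
  obtain ⟨c, hc0, hcπ, hcd, hcv⟩ := exists_curve_in_fibre (B.submersion_proj.isSubmersionAt p) hv
  subst hc0
  change mfderiv 𝓘(ℝ, ℝ) 𝓘(ℝ, EP) c 0 (1 : ℝ) = v at hcv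
  subst hcv
  have hmom : ∀ᶠ τ in 𝓝 (0 : ℝ), B.mom (c τ) ∈ β.base.source :=
    hcd.continuousAt.eventually (eventually_mom_mem hp)
  have hR := mdifferentiableAt_rightTrans hp
  have h1 := mfderiv_comp_apply 0 hR hcd (1 : ℝ)
  have hmem : mfderiv 𝓘(ℝ, ℝ) 𝓘(ℝ, EP) (B.rightTrans β ∘ c) 0 (1 : ℝ) ∈
      B.vertical (B.rightTrans β (c 0)) := by
    rw [h1]
    exact mfderiv_rightTrans_mem_vertical hp hv
  obtain ⟨hd, h2⟩ := divTangent_mfderiv hcd (hcπ.mono fun _ h => h.symm) (1 : ℝ) hv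
  obtain ⟨-, h3⟩ := divTangent_mfderiv (hR.comp 0 hcd) (by
    filter_upwards [hcπ, hmom] with τ h h'
    exact (proj_rightTrans hp).trans (h.symm.trans (proj_rightTrans h').symm)) (1 : ℝ) hmem
  have h4 : (fun τ => B.div (B.rightTrans β (c 0)) (B.rightTrans β (c τ))) =ᶠ[𝓝 0]
      β.inv.conj ∘ fun τ => B.div (c 0) (c τ) := by
    filter_upwards [hcπ, hmom] with τ h h' using div_rightTrans h.symm hp h'
  have hone := B.div_self (c 0)
  have hconj : MDifferentiableAt 𝓘(ℝ, EG) 𝓘(ℝ, EG) β.inv.conj (B.div (c 0) (c 0)) := by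
    rw [hone]
    exact (β.inv.contMDiffAt_conj (by rw [𝒢.src_one]; exact hp)
      (by rw [𝒢.tgt_one]; exact hp)).mdifferentiableAt (by simp)
  have h5 := mfderiv_comp_apply (0 : ℝ) hconj hd (1 : ℝ)
  have h6 : (mfderiv 𝓘(ℝ, EG) 𝓘(ℝ, EG) β.inv.conj (B.div (c 0) (c 0)) : EG →L[ℝ] EG) =
      mfderiv 𝓘(ℝ, EG) 𝓘(ℝ, EG) β.inv.conj (𝒢.one (B.mom (c 0))) := by rw [hone]
  have h7 : (⟨_, mfderiv_rightTrans_mem_vertical hp hv⟩ : B.vertical (B.rightTrans β (c 0))) =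
      ⟨_, hmem⟩ := Subtype.ext h1.symm
  have h8 : (mfderiv 𝓘(ℝ, ℝ) 𝓘(ℝ, EG)
      (fun τ => B.div (B.rightTrans β (c 0)) (B.rightTrans β (c τ))) 0 (1 : ℝ) : EG) =
      mfderiv 𝓘(ℝ, ℝ) 𝓘(ℝ, EG) (β.inv.conj ∘ fun τ => B.div (c 0) (c τ)) 0 (1 : ℝ) :=
    congrArg (fun A : ℝ →L[ℝ] EG => A 1) h4.mfderiv_eq
  rw [h7]
  refine h3.trans (h8.trans (h5.trans ?_))
  exact (congrArg (fun u : EG => (mfderiv 𝓘(ℝ, EG) 𝓘(ℝ, EG) β.inv.conj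
    (B.div (c 0) (c 0)) : EG →L[ℝ] EG) u) h2.symm).trans
    (congrArg (fun A : EG →L[ℝ] EG => A (B.divTangent (c 0) ⟨_, hv⟩).1) h6)

/-- On a vector which `ε` annihilates, the derivative of `R_β` is the tangent action of the arrow
`β(ε(p))`; it does not depend on the other values of `β`. -/
theorem mfderiv_rightTrans_eq_actTangent {v : TangentSpace 𝓘(ℝ, EP) p}
    (hp : B.mom p ∈ β.base.source) (hv : mfderiv 𝓘(ℝ, EP) 𝓘(ℝ, E₀) B.mom p v = 0) :
    mfderiv 𝓘(ℝ, EP) 𝓘(ℝ, EP) (B.rightTrans β) p v =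
      B.actTangent p (β.toFun (B.mom p)) v := by
  have hm : MDifferentiableAt 𝓘(ℝ, EP) 𝓘(ℝ, E₀) B.mom p :=
    B.smooth_mom.mdifferentiableAt (by simp)
  have hβ : MDifferentiableAt 𝓘(ℝ, E₀) 𝓘(ℝ, EG) β.toFun (B.mom p) :=
    (β.smooth_toFun.contMDiffAt (β.base.open_source.mem_nhds hp)).mdifferentiableAt (by simp)
  let S : Set (P × G) := {q | B.mom q.1 = 𝒢.src q.2}
  let j : P → P × G := fun q => (q, (β.toFun ∘ B.mom) q)
  have hj : HasMFDerivAt 𝓘(ℝ, EP) (𝓘(ℝ, EP).prod 𝓘(ℝ, EG)) j p _ :=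
    (hasMFDerivAt_id p).prodMk (hβ.hasMFDerivAt.comp p hm.hasMFDerivAt)
  have ha : MDifferentiableWithinAt (𝓘(ℝ, EP).prod 𝓘(ℝ, EG)) 𝓘(ℝ, EP)
      (fun q : P × G => B.act q.1 q.2) S (j p) :=
    (B.smooth_act _ (β.src_toFun _ hp).symm).mdifferentiableWithinAt (by simp)
  have hT : j ⁻¹' S ∈ 𝓝 p := by
    filter_upwards [eventually_mom_mem hp] with q hq using (β.src_toFun _ hq).symm
  have h1 := (ha.hasMFDerivWithinAt.comp p (hj.hasMFDerivWithinAt (s := j ⁻¹' S))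
    fun _ h => h).hasMFDerivAt hT
  refine (congrArg (fun A : EP →L[ℝ] EP => A v) h1.mfderiv).trans ?_
  have h2 : ((v, mfderiv 𝓘(ℝ, E₀) 𝓘(ℝ, EG) β.toFun (B.mom p)
      (mfderiv 𝓘(ℝ, EP) 𝓘(ℝ, E₀) B.mom p v)) : EP × EG) = (v, 0) := by
    rw [hv, map_zero]; rfl
  exact congrArg (fun u : EP × EG => (mfderivWithin (𝓘(ℝ, EP).prod 𝓘(ℝ, EG)) 𝓘(ℝ, EP)
    (fun q : P × G => B.act q.1 q.2) S (j p) : EP × EG →L[ℝ] EP) u) h2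

end PrincipalBundle

end

/-! ### Invariance of the connection and of its curvature -/

section

variable {EG E₀ EP EM G G₀ P M : Type*}
  [NormedAddCommGroup EG] [NormedSpace ℝ EG] [NormedAddCommGroup E₀] [NormedSpace ℝ E₀]
  [TopologicalSpace G] [ChartedSpace EG G] [TopologicalSpace G₀] [ChartedSpace E₀ G₀]
  [NormedAddCommGroup EP] [NormedSpace ℝ EP]
  [NormedAddCommGroup EM] [NormedSpace ℝ EM] [TopologicalSpace P] [ChartedSpace EP P]
  [TopologicalSpace M] [ChartedSpace EM M]
  {𝒢 : LieGroupoid EG E₀ G G₀} [IsManifold 𝓘(ℝ, EP) ∞ P]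
  {B : PrincipalBundle EP EM P M 𝒢}

namespace HorizontalDistribution

theorem hor_of_mem (H : HorizontalDistribution B) {p : P} {v : TangentSpace 𝓘(ℝ, EP) p}
    (hv : v ∈ H.space p) : H.hor p v = v :=
  Submodule.projection_apply_of_mem_left (H.isCompl p).symm hv

theorem hor_eq_zero_of_mem_vertical (H : HorizontalDistribution B) {p : P}
    {v : TangentSpace 𝓘(ℝ, EP) p} (hv : v ∈ B.vertical p) : H.hor p v = 0 :=
  Submodule.projection_apply_right (H.isCompl p).symm ⟨v, hv⟩

theorem hor_hor (H : HorizontalDistribution B) (p : P) (v : TangentSpace 𝓘(ℝ, EP) p) :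
    H.hor p (H.hor p v) = H.hor p v := H.hor_of_mem (H.hor_mem p v)

theorem hor_add_ver (H : HorizontalDistribution B) (p : P) (v : TangentSpace 𝓘(ℝ, EP) p) :
    H.hor p v + H.ver p v = v := by
  have h := Submodule.projection_add_projection_eq_self (H.isCompl p).symm v
  rwa [Submodule.projection_apply (H.isCompl p)] at h

theorem ver_of_mem_vertical (H : HorizontalDistribution B) {p : P}
    {v : TangentSpace 𝓘(ℝ, EP) p} (hv : v ∈ B.vertical p) : H.ver p v = ⟨v, hv⟩ :=
  Submodule.projectionOnto_apply_left (H.isCompl p) ⟨v, hv⟩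

/-- The Ehresmann curvature is a horizontal form. -/
theorem ehresmannCurvature_hor [FiniteDimensional ℝ EP] (H : HorizontalDistribution B) (p : P)
    (u v : TangentSpace 𝓘(ℝ, EP) p) :
    H.ehresmannCurvature p (H.hor p u) (H.hor p v) = H.ehresmannCurvature p u v := by
  have hu : MDiffAt (T% (FiberBundle.extend EP u)) p := FiberBundle.mdifferentiableAt_extend ..
  have hv : MDiffAt (T% (FiberBundle.extend EP v)) p := FiberBundle.mdifferentiableAt_extend ..
  have h := H.curvatureField_eq (H.mdifferentiableAt_hor hu) (H.mdifferentiableAt_hor hv)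
  simp only [FiberBundle.extend_apply_self] at h
  rw [← h]
  simp only [ehresmannCurvature, curvatureField, hor_hor]

theorem ehresmannCurvature_congr [FiniteDimensional ℝ EP] (H : HorizontalDistribution B) {p : P}
    {u v u' v' : TangentSpace 𝓘(ℝ, EP) p} (hu : H.hor p u = H.hor p u')
    (hv : H.hor p v = H.hor p v') :
    H.ehresmannCurvature p u v = H.ehresmannCurvature p u' v' := by
  rw [← H.ehresmannCurvature_hor p u v, hu, hv, H.ehresmannCurvature_hor]

end HorizontalDistribution

namespace PrincipalConnection

variable (H : PrincipalConnection B) {β : LocalBisection 𝒢} {p : P}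

theorem mfderiv_rightTrans_mem_space {v : TangentSpace 𝓘(ℝ, EP) p}
    (hp : B.mom p ∈ β.base.source) (hv : v ∈ H.space p) :
    mfderiv 𝓘(ℝ, EP) 𝓘(ℝ, EP) (B.rightTrans β) p v ∈ H.space (B.rightTrans β p) := by
  have h : B.actTangent p (β.toFun (B.mom p)) v ∈ H.space (B.act p (β.toFun (B.mom p))) := by
    rw [H.map_space p _ (β.src_toFun _ hp).symm]
    exact Submodule.mem_map_of_mem hv
  rw [B.mfderiv_rightTrans_eq_actTangent hp (H.mom_space p v hv)]
  exact h

theorem hor_mfderiv_rightTrans (hp : B.mom p ∈ β.base.source) (v : TangentSpace 𝓘(ℝ, EP) p) :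
    H.hor (B.rightTrans β p) (mfderiv 𝓘(ℝ, EP) 𝓘(ℝ, EP) (B.rightTrans β) p v) =
      mfderiv 𝓘(ℝ, EP) 𝓘(ℝ, EP) (B.rightTrans β) p (H.hor p v) := by
  conv_lhs => rw [← H.hor_add_ver p v, map_add, map_add]
  rw [H.hor_of_mem (H.mfderiv_rightTrans_mem_space hp (H.hor_mem p v)),
    H.hor_eq_zero_of_mem_vertical (B.mfderiv_rightTrans_mem_vertical hp (H.ver p v).2), add_zero]

theorem ver_mfderiv_rightTrans (hp : B.mom p ∈ β.base.source) (v : TangentSpace 𝓘(ℝ, EP) p) :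
    H.ver (B.rightTrans β p) (mfderiv 𝓘(ℝ, EP) 𝓘(ℝ, EP) (B.rightTrans β) p v) =
      ⟨_, B.mfderiv_rightTrans_mem_vertical hp (H.ver p v).2⟩ := by
  conv_lhs => rw [← H.hor_add_ver p v, map_add, map_add]
  rw [H.ver_of_mem (H.mfderiv_rightTrans_mem_space hp (H.hor_mem p v)),
    H.ver_of_mem_vertical (B.mfderiv_rightTrans_mem_vertical hp (H.ver p v).2), zero_add]

theorem connectionForm_mfderiv_rightTrans [IsManifold 𝓘(ℝ, EM) ∞ M]
    (hp : B.mom p ∈ β.base.source) (v : TangentSpace 𝓘(ℝ, EP) p) :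
    (show EG from (H.connectionForm (B.rightTrans β p)
      (mfderiv 𝓘(ℝ, EP) 𝓘(ℝ, EP) (B.rightTrans β) p v)).1) =
      (show EG from (β.AdInv ⟨B.mom p, hp⟩ (H.connectionForm p v)).1) := by
  refine Eq.trans ?_ (B.divTangent_mfderiv_rightTrans hp (H.ver p v).2)
  exact congrArg (fun w => (show EG from (B.divTangent (B.rightTrans β p) w).1))
    (H.ver_mfderiv_rightTrans hp v)

/-- Since `R_β` is a local diffeomorphism that commutes with the horizontal and the vertical
projections, it maps the Ehresmann curvature to itself. -/
theorem ehresmannCurvature_mfderiv_rightTrans [FiniteDimensional ℝ EP]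
    (hp : B.mom p ∈ β.base.source) (u v : TangentSpace 𝓘(ℝ, EP) p) :
    H.ehresmannCurvature (B.rightTrans β p)
      (mfderiv 𝓘(ℝ, EP) 𝓘(ℝ, EP) (B.rightTrans β) p u)
      (mfderiv 𝓘(ℝ, EP) 𝓘(ℝ, EP) (B.rightTrans β) p v) =
      ⟨_, B.mfderiv_rightTrans_mem_vertical hp (H.ehresmannCurvature p u v).2⟩ := by
  have : CompleteSpace EP := FiniteDimensional.complete ℝ EP
  have : IsManifold 𝓘(ℝ, EP) 2 P := IsManifold.of_le (n := ∞) ENat.LEInfty.out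
  have : IsManifold 𝓘(ℝ, EP) (minSmoothness ℝ 2) P := by
    simpa [minSmoothness_of_isRCLikeNormedField] using this
  let f := B.rightTrans β
  have hf : ContMDiffAt 𝓘(ℝ, EP) 𝓘(ℝ, EP) ∞ f p := B.contMDiffAt_rightTrans hp
  have hinv : ∀ {q : P}, B.mom q ∈ β.base.source →
      (mfderiv 𝓘(ℝ, EP) 𝓘(ℝ, EP) f q).IsInvertible := B.isInvertible_mfderiv_rightTrans
  -- the pullback by `f` of a vector field on a neighbourhood of `f p` with the value `f_* w`
  let X (w : TangentSpace 𝓘(ℝ, EP) p) : ∀ q : P, TangentSpace 𝓘(ℝ, EP) q :=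
    FiberBundle.extend EP (mfderiv 𝓘(ℝ, EP) 𝓘(ℝ, EP) f p w : TangentSpace 𝓘(ℝ, EP) (f p))
  let Y (w : TangentSpace 𝓘(ℝ, EP) p) := VectorField.mpullback 𝓘(ℝ, EP) 𝓘(ℝ, EP) f (X w)
  have hX : ∀ w, MDiffAt (T% (X w)) (f p) := fun w => FiberBundle.mdifferentiableAt_extend ..
  have hY : ∀ w, MDiffAt (T% (Y w)) p := fun w =>
    (hX w).mpullback_vectorField hf (hinv hp) ENat.LEInfty.out
  have hYp : ∀ w, Y w p = w := fun w => by
    simp only [Y, X, VectorField.mpullback_apply, FiberBundle.extend_apply_self]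
    exact (hinv hp).inverse_apply_eq.mpr rfl
  have hpull : ∀ w, VectorField.mpullback 𝓘(ℝ, EP) 𝓘(ℝ, EP) f (fun q => H.hor q (X w q)) =ᶠ[𝓝 p]
      fun q => H.hor q (Y w q) := fun w => by
    filter_upwards [B.eventually_mom_mem hp] with q hq
    rw [VectorField.mpullback_apply]
    refine (hinv hq).inverse_apply_eq.mpr ?_
    rw [← H.hor_mfderiv_rightTrans hq]
    congr 1
    exact (hinv hq).inverse_apply_eq.mp rfl
  have hbr := VectorField.mpullback_mlieBracket (H.mdifferentiableAt_hor (hX u))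
    (H.mdifferentiableAt_hor (hX v)) hf
    (by rw [minSmoothness_of_isRCLikeNormedField]; exact ENat.LEInfty.out)
  rw [(hpull u).mlieBracket_vectorField_eq (hpull v), VectorField.mpullback_apply,
    (hinv hp).inverse_apply_eq] at hbr
  have hcurv := H.curvatureField_eq (hY u) (hY v)
  rw [hYp, hYp] at hcurv
  rw [← hcurv]
  change -H.ver (f p) (VectorField.mlieBracket 𝓘(ℝ, EP) (fun q => H.hor q (X u q))
    (fun q => H.hor q (X v q)) (f p)) = _
  rw [hbr, H.ver_mfderiv_rightTrans hp]
  refine Subtype.ext ?_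
  simp only [HorizontalDistribution.curvatureField]
  exact (map_neg (mfderiv 𝓘(ℝ, EP) 𝓘(ℝ, EP) f p) _).symm

theorem curvature_mfderiv_rightTrans [FiniteDimensional ℝ EP] [IsManifold 𝓘(ℝ, EM) ∞ M]
    (hp : B.mom p ∈ β.base.source) (u v : TangentSpace 𝓘(ℝ, EP) p) :
    (show EG from (H.curvature (B.rightTrans β p)
      (mfderiv 𝓘(ℝ, EP) 𝓘(ℝ, EP) (B.rightTrans β) p u)
      (mfderiv 𝓘(ℝ, EP) 𝓘(ℝ, EP) (B.rightTrans β) p v)).1) =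
      (show EG from (β.AdInv ⟨B.mom p, hp⟩ (H.curvature p u v)).1) := by
  refine Eq.trans ?_ (B.divTangent_mfderiv_rightTrans hp (H.ehresmannCurvature p u v).2)
  exact congrArg (fun w => (show EG from (B.divTangent (B.rightTrans β p) w).1))
    (H.ehresmannCurvature_mfderiv_rightTrans hp u v)

end PrincipalConnection

end

/-! ### The product rule for a smooth family of bisections -/

section

/-- The derivative of `n ↦ F (n, n)` is the sum of the partial derivatives of `F`. -/
theorem mfderiv_diagonal {EN EP N P : Type*} [NormedAddCommGroup EN] [NormedSpace ℝ EN]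
    [NormedAddCommGroup EP] [NormedSpace ℝ EP] [TopologicalSpace N] [ChartedSpace EN N]
    [TopologicalSpace P] [ChartedSpace EP P] {F : N × N → P} {n : N}
    (hF : MDifferentiableAt (𝓘(ℝ, EN).prod 𝓘(ℝ, EN)) 𝓘(ℝ, EP) F (n, n))
    (X : TangentSpace 𝓘(ℝ, EN) n) :
    mfderiv 𝓘(ℝ, EN) 𝓘(ℝ, EP) (fun k => F (k, k)) n X =
      mfderiv 𝓘(ℝ, EN) 𝓘(ℝ, EP) (fun k => F (k, n)) n X +
        mfderiv 𝓘(ℝ, EN) 𝓘(ℝ, EP) (fun k => F (n, k)) n X := by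
  have h : HasMFDerivAt 𝓘(ℝ, EN) (𝓘(ℝ, EN).prod 𝓘(ℝ, EN)) (fun k : N => (k, k)) n _ :=
    (hasMFDerivAt_id n).prodMk (hasMFDerivAt_id n)
  have h1 := HasMFDerivAt.comp (f := fun k : N => (k, k)) n hF.hasMFDerivAt h
  refine (congrArg (fun A : EN →L[ℝ] EP => A X) h1.mfderiv).trans ?_
  exact mfderiv_prod_eq_add_apply (v := ((X, X) : EN × EN)) hF

variable {EG E₀ EP EM G G₀ P M : Type*}
  [NormedAddCommGroup EG] [NormedSpace ℝ EG] [NormedAddCommGroup E₀] [NormedSpace ℝ E₀]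
  [TopologicalSpace G] [ChartedSpace EG G] [TopologicalSpace G₀] [ChartedSpace E₀ G₀]
  [NormedAddCommGroup EP] [NormedSpace ℝ EP]
  [NormedAddCommGroup EM] [NormedSpace ℝ EM] [TopologicalSpace P] [ChartedSpace EP P]
  [TopologicalSpace M] [ChartedSpace EM M]
  {𝒢 : LieGroupoid EG E₀ G G₀} {B : PrincipalBundle EP EM P M 𝒢}

namespace BisectionMap

variable (γ : BisectionMap EM M 𝒢) {m : M}

theorem contMDiffAt_apply {q : M × G₀} (hq : q.2 ∈ (γ.toFun q.1).base.source) :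
    ContMDiffAt (𝓘(ℝ, EM).prod 𝓘(ℝ, E₀)) 𝓘(ℝ, EG) ∞
      (fun q : M × G₀ => (γ.toFun q.1).toFun q.2) q :=
  γ.smooth_toFun.contMDiffAt (γ.isOpen_domain.mem_nhds hq)

/-- The map `(k, q) ↦ R_{γ(k)}(q)` is smooth on the open set where it is defined. -/
theorem contMDiffAt_rightTrans {z : M × P} (hz : B.mom z.2 ∈ (γ.toFun z.1).base.source) :
    ContMDiffAt (𝓘(ℝ, EM).prod 𝓘(ℝ, EP)) 𝓘(ℝ, EP) ∞
      (fun z : M × P => B.rightTrans (γ.toFun z.1) z.2) z := by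
  let W : Set (M × P) := {z | B.mom z.2 ∈ (γ.toFun z.1).base.source}
  have h0 : ContMDiff (𝓘(ℝ, EM).prod 𝓘(ℝ, EP)) (𝓘(ℝ, EM).prod 𝓘(ℝ, E₀)) ∞
      (fun z : M × P => (z.1, B.mom z.2)) :=
    contMDiff_fst.prodMk (B.smooth_mom.comp contMDiff_snd)
  have hW : IsOpen W := γ.isOpen_domain.preimage h0.continuous
  have h1 : ContMDiffOn (𝓘(ℝ, EM).prod 𝓘(ℝ, EP)) 𝓘(ℝ, EG) ∞
      (fun z : M × P => (γ.toFun z.1).toFun (B.mom z.2)) W :=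
    γ.smooth_toFun.comp h0.contMDiffOn fun _ h => h
  have h2 : ContMDiffOn (𝓘(ℝ, EM).prod 𝓘(ℝ, EP)) 𝓘(ℝ, EP) ∞
      (fun z : M × P => B.rightTrans (γ.toFun z.1) z.2) W :=
    B.smooth_act.comp (contMDiffOn_snd.prodMk h1)
      fun z hz => ((γ.toFun z.1).src_toFun _ hz).symm
  exact h2.contMDiffAt (hW.mem_nhds hz)

theorem eventually_mem_source {x : G₀} (hx : x ∈ (γ.toFun m).base.source) :
    ∀ᶠ k in 𝓝 m, x ∈ (γ.toFun k).base.source :=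
  (Continuous.prodMk_left x).continuousAt.preimage_mem_nhds (γ.isOpen_domain.mem_nhds hx)

variable {p : P}

theorem mdifferentiableAt_rightTrans_left (hp : B.mom p ∈ (γ.toFun m).base.source) :
    MDifferentiableAt 𝓘(ℝ, EM) 𝓘(ℝ, EP) (fun k => B.rightTrans (γ.toFun k) p) m :=
  ((γ.contMDiffAt_rightTrans (z := (m, p)) hp).comp m
    (contMDiffAt_id.prodMk contMDiffAt_const)).mdifferentiableAt (by simp)

theorem mfderiv_rightTrans_left_mem_vertical (hp : B.mom p ∈ (γ.toFun m).base.source)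
    (X : TangentSpace 𝓘(ℝ, EM) m) :
    mfderiv 𝓘(ℝ, EM) 𝓘(ℝ, EP) (fun k => B.rightTrans (γ.toFun k) p) m X ∈
      B.vertical (B.rightTrans (γ.toFun m) p) := by
  have h1 : B.proj ∘ (fun k => B.rightTrans (γ.toFun k) p) =ᶠ[𝓝 m] fun _ => B.proj p := by
    filter_upwards [γ.eventually_mem_source hp] with k hk using B.proj_rightTrans hk
  have h2 := mfderiv_comp_apply m
    (B.mdifferentiableAt_proj (p := B.rightTrans (γ.toFun m) p))
    (γ.mdifferentiableAt_rightTrans_left hp) X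
  exact h2.symm.trans (congrArg (fun A : EM →L[ℝ] EM => A X)
    (h1.mfderiv_eq.trans (mfderiv_const (I := 𝓘(ℝ, EM)) (I' := 𝓘(ℝ, EM)))))

/-- Moving the bisection while `p` is fixed gives a vertical vector; under the identification of the
vertical space with the fibre of the Lie algebroid it is the Maurer-Cartan form. -/
theorem divTangent_mfderiv_rightTrans_left [IsManifold 𝓘(ℝ, EP) ∞ P] [IsManifold 𝓘(ℝ, EM) ∞ M]
    (hp : B.mom p ∈ (γ.toFun m).base.source) (X : TangentSpace 𝓘(ℝ, EM) m) :
    (show EG from (B.divTangent (B.rightTrans (γ.toFun m) p)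
      ⟨_, γ.mfderiv_rightTrans_left_mem_vertical hp X⟩).1) =
      (show EG from (γ.pullbackMC m ⟨B.mom p, hp⟩ X).1) := by
  have hev := γ.eventually_mem_source hp
  have hc : MDifferentiableAt 𝓘(ℝ, EM) 𝓘(ℝ, EG) (fun k => (γ.toFun k).toFun (B.mom p)) m :=
    ((γ.contMDiffAt_apply (q := (m, B.mom p)) hp).comp m
      (contMDiffAt_id.prodMk contMDiffAt_const)).mdifferentiableAt (by simp)
  have h1 := (B.divTangent_mfderiv (γ.mdifferentiableAt_rightTrans_left hp) (by
    filter_upwards [hev] with k hk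
    exact (B.proj_rightTrans hp).trans (B.proj_rightTrans hk).symm) X
    (γ.mfderiv_rightTrans_left_mem_vertical hp X)).2
  have h2 : (fun k => B.div (B.rightTrans (γ.toFun m) p) (B.rightTrans (γ.toFun k) p)) =ᶠ[𝓝 m]
      (γ.toFun m).inv.leftTrans ∘ fun k => (γ.toFun k).toFun (B.mom p) := by
    filter_upwards [hev] with k hk
    have hs := (γ.toFun k).src_toFun _ hk
    rw [Function.comp_apply, (γ.toFun m).inv_leftTrans_apply (by rwa [hs]), hs]
    exact B.div_act_act ((γ.toFun m).src_toFun _ hp).symm hs.symm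
  have hL : MDifferentiableAt 𝓘(ℝ, EG) 𝓘(ℝ, EG) (γ.toFun m).inv.leftTrans
      ((γ.toFun m).toFun (B.mom p)) :=
    ((γ.toFun m).inv.contMDiffAt_leftTrans (by
      rw [(γ.toFun m).src_toFun _ hp]; exact hp)).mdifferentiableAt (by simp)
  have h3 := mfderiv_comp_apply m hL hc X
  -- the Maurer-Cartan form is evaluated at `(t ∘ γ(m))⁻¹ (t ∘ γ(m)) (ε(p))`, which is `ε(p)`
  have h4 : ∀ x : G₀, x = B.mom p →
      (show EG from mfderiv 𝓘(ℝ, EG) 𝓘(ℝ, EG) (γ.toFun m).inv.leftTrans ((γ.toFun m).toFun x)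
        (show EG from mfderiv 𝓘(ℝ, EM) 𝓘(ℝ, EG) (fun k => (γ.toFun k).toFun x) m X)) =
      mfderiv 𝓘(ℝ, EG) 𝓘(ℝ, EG) (γ.toFun m).inv.leftTrans ((γ.toFun m).toFun (B.mom p))
        (mfderiv 𝓘(ℝ, EM) 𝓘(ℝ, EG) (fun k => (γ.toFun k).toFun (B.mom p)) m X) := by
    rintro _ rfl
    rfl
  exact h1.trans ((congrArg (fun A : EM →L[ℝ] EG => A X) h2.mfderiv_eq).trans (h3.trans
    (h4 _ ((γ.toFun m).base.left_inv hp)).symm))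

end BisectionMap

namespace LocalSection

variable {U : TopologicalSpace.Opens M} (σ : LocalSection B U) (γ : BisectionMap EM M 𝒢)
  (hγ : ∀ m ∈ U, σ.mom m ∈ (γ.toFun m).base.source) {m : M}

/-- The product rule: the derivative of `σ · γ` is `(R_{γ(m)})_* σ_* X` plus the derivative of
`k ↦ R_{γ(k)}(σ(m))`. -/
theorem mfderiv_gauge (hm : m ∈ U) (X : TangentSpace 𝓘(ℝ, EM) m) :
    mfderiv 𝓘(ℝ, EM) 𝓘(ℝ, EP) (σ.gauge γ hγ).toFun m X =
      (show EP from mfderiv 𝓘(ℝ, EP) 𝓘(ℝ, EP) (B.rightTrans (γ.toFun m)) (σ.toFun m)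
        (mfderiv 𝓘(ℝ, EM) 𝓘(ℝ, EP) σ.toFun m X)) +
      (show EP from
        mfderiv 𝓘(ℝ, EM) 𝓘(ℝ, EP) (fun k => B.rightTrans (γ.toFun k) (σ.toFun m)) m X) := by
  have hσ : MDifferentiableAt 𝓘(ℝ, EM) 𝓘(ℝ, EP) σ.toFun m :=
    (σ.smooth_toFun.contMDiffAt (U.isOpen.mem_nhds hm)).mdifferentiableAt (by simp)
  have hσ' : MDifferentiableAt (𝓘(ℝ, EM).prod 𝓘(ℝ, EM)) (𝓘(ℝ, EM).prod 𝓘(ℝ, EP))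
      (fun z : M × M => (z.2, σ.toFun z.1)) (m, m) :=
    mdifferentiableAt_snd.prodMk (MDifferentiableAt.comp (m, m) hσ mdifferentiableAt_fst)
  have hF : MDifferentiableAt (𝓘(ℝ, EM).prod 𝓘(ℝ, EM)) 𝓘(ℝ, EP)
      (fun z : M × M => B.rightTrans (γ.toFun z.2) (σ.toFun z.1)) (m, m) :=
    MDifferentiableAt.comp (m, m) ((γ.contMDiffAt_rightTrans (z := (m, σ.toFun m))
      (hγ m hm)).mdifferentiableAt (by simp)) hσ'
  refine (mfderiv_diagonal hF X).trans ?_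
  exact congrArg (fun u : EP => u + (show EP from
    mfderiv 𝓘(ℝ, EM) 𝓘(ℝ, EP) (fun k => B.rightTrans (γ.toFun k) (σ.toFun m)) m X))
    (mfderiv_comp_apply m (B.mdifferentiableAt_rightTrans (hγ m hm)) hσ X)

end LocalSection

end

end

end GroupoidGauge

theorem theorem3p6
    {EG E₀ EP EM G G₀ P M : Type*}
    [NormedAddCommGroup EG] [NormedSpace ℝ EG] [FiniteDimensional ℝ EG]
    [NormedAddCommGroup E₀] [NormedSpace ℝ E₀] [FiniteDimensional ℝ E₀]
    [NormedAddCommGroup EP] [NormedSpace ℝ EP] [FiniteDimensional ℝ EP]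
    [NormedAddCommGroup EM] [NormedSpace ℝ EM] [FiniteDimensional ℝ EM]
    [TopologicalSpace G] [ChartedSpace EG G] [IsManifold 𝓘(ℝ, EG) ∞ G]
    [TopologicalSpace G₀] [ChartedSpace E₀ G₀] [IsManifold 𝓘(ℝ, E₀) ∞ G₀]
    [TopologicalSpace P] [ChartedSpace EP P] [IsManifold 𝓘(ℝ, EP) ∞ P]
    [TopologicalSpace M] [ChartedSpace EM M] [IsManifold 𝓘(ℝ, EM) ∞ M]
    (𝒢 : GroupoidGauge.LieGroupoid EG E₀ G G₀)
    (B : GroupoidGauge.PrincipalBundle EP EM P M 𝒢)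
    (H : GroupoidGauge.PrincipalConnection B)
    (U : TopologicalSpace.Opens M)
    (σ : GroupoidGauge.LocalSection B U)
    (γ : GroupoidGauge.BisectionMap EM M 𝒢)
    (hγ : ∀ m ∈ U, σ.mom m ∈ (γ.toFun m).base.source)
    (m : M) (hm : m ∈ U) :
    (∀ X : TangentSpace 𝓘(ℝ, EM) m,
      (⟨(σ.gauge γ hγ).mom m, (σ.gauge γ hγ).form H.toHorizontalDistribution m X⟩ :
          𝒢.Algebroid) =
        ⟨(γ.toFun m).base (σ.mom m),
          (γ.toFun m).AdInv ⟨σ.mom m, hγ m hm⟩ (σ.form H.toHorizontalDistribution m X) +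
            γ.pullbackMC m ⟨σ.mom m, hγ m hm⟩ X⟩) ∧
    (∀ X Y : TangentSpace 𝓘(ℝ, EM) m,
      (⟨(σ.gauge γ hγ).mom m, (σ.gauge γ hγ).curvature H.toHorizontalDistribution m X Y⟩ :
          𝒢.Algebroid) =
        ⟨(γ.toFun m).base (σ.mom m),
          (γ.toFun m).AdInv ⟨σ.mom m, hγ m hm⟩
            (σ.curvature H.toHorizontalDistribution m X Y)⟩) := by
  have hp : B.mom (σ.toFun m) ∈ (γ.toFun m).base.source := hγ m hm
  have hmom : (σ.gauge γ hγ).mom m = (γ.toFun m).base (σ.mom m) := B.mom_rightTrans hp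
  refine ⟨fun X => GroupoidGauge.LieGroupoid.Algebroid.ext hmom ?_,
    fun X Y => GroupoidGauge.LieGroupoid.Algebroid.ext hmom ?_⟩
  -- `(σ · γ)_* X = R + w` with `R = (R_{γ(m)})_* σ_* X` and `w` vertical
  · let R : TangentSpace 𝓘(ℝ, EP) (B.rightTrans (γ.toFun m) (σ.toFun m)) :=
      mfderiv 𝓘(ℝ, EP) 𝓘(ℝ, EP) (B.rightTrans (γ.toFun m)) (σ.toFun m)
        (mfderiv 𝓘(ℝ, EM) 𝓘(ℝ, EP) σ.toFun m X)
    let w : B.vertical (B.rightTrans (γ.toFun m) (σ.toFun m)) :=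
      ⟨_, γ.mfderiv_rightTrans_left_mem_vertical hp X⟩
    have h1 : H.connectionForm (B.rightTrans (γ.toFun m) (σ.toFun m)) (R + w.1) =
        H.connectionForm _ R + B.divTangent _ w := by
      rw [map_add]
      exact congrArg (fun u => H.connectionForm _ R + B.divTangent _ u)
        (H.ver_of_mem_vertical w.2)
    refine (congrArg (fun u : EP => (show EG from
      (H.connectionForm (B.rightTrans (γ.toFun m) (σ.toFun m)) u).1))
      (σ.mfderiv_gauge γ hγ hm X)).trans ?_
    refine (congrArg Subtype.val h1).trans ?_
    exact congrArg₂ (fun a b : EG => a + b) (H.connectionForm_mfderiv_rightTrans hp _)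
      (γ.divTangent_mfderiv_rightTrans_left hp X)
  -- `Ω` is horizontal, so the vertical part of the derivative of `σ · γ` can be dropped
  · have h1 : ∀ X : TangentSpace 𝓘(ℝ, EM) m,
        H.hor (B.rightTrans (γ.toFun m) (σ.toFun m))
          (mfderiv 𝓘(ℝ, EM) 𝓘(ℝ, EP) (σ.gauge γ hγ).toFun m X : EP) =
        H.hor (B.rightTrans (γ.toFun m) (σ.toFun m))
          (mfderiv 𝓘(ℝ, EP) 𝓘(ℝ, EP) (B.rightTrans (γ.toFun m)) (σ.toFun m)
            (mfderiv 𝓘(ℝ, EM) 𝓘(ℝ, EP) σ.toFun m X)) := fun X => by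
      let w : TangentSpace 𝓘(ℝ, EP) (B.rightTrans (γ.toFun m) (σ.toFun m)) :=
        mfderiv 𝓘(ℝ, EM) 𝓘(ℝ, EP) (fun k => B.rightTrans (γ.toFun k) (σ.toFun m)) m X
      have hw : H.hor _ w = 0 :=
        H.hor_eq_zero_of_mem_vertical (γ.mfderiv_rightTrans_left_mem_vertical hp X)
      refine (congrArg (fun u : EP => H.hor (B.rightTrans (γ.toFun m) (σ.toFun m)) u)
        (σ.mfderiv_gauge γ hγ hm X)).trans ?_
      exact (map_add (H.hor (B.rightTrans (γ.toFun m) (σ.toFun m))) _ w).trans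
        ((congrArg _ hw).trans (add_zero _))
    refine Eq.trans ?_ (H.curvature_mfderiv_rightTrans hp _ _)
    exact congrArg (fun w => (show EG from
      (B.divTangent (B.rightTrans (γ.toFun m) (σ.toFun m)) w).1))
      (H.ehresmannCurvature_congr (h1 X) (h1 Y))
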